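/- All Banach spaces are real. A metric space $(M,d)$ is *stable* if $\lim_{i,\mathcal U}\lim_{j,\mathcal V} d(x_i,y_j)=\lim_{j,\mathcal V}\lim_{i,\mathcal U} d(x_i,y_j)$ for all bounded sequences $(x_i)$, $(y_j)$ in $M$ and all nonprincipal ultrafilters $\mathcal U,\mathcal V$ on $\mathbb N$. A Banach space $W$ is *finitely representable* in a Banach space $Y$ if for every finite-dimensional subspace $E\subseteq W$ and every $\varepsilon>0$ there are a subspace $F\subseteq Y$ and a linear isomorphism $T\colon E\to F$ with $\|T\|\,\|T^{-1}\|<1+\varepsilon$; $Y$ is *superstable* if every Banach space that is finitely representable in $Y$ is stable (in the metric of its norm). A map $f\colon X\to Y$ between Banach spaces is *almost uncollapsed* if there is $t>0$ with $\inf\{\|f(x)-f(y)\| : x,y\in X,\ \|x-y\|=t\}>0$ (where $\inf\emptyset=\infty$). A map between metric spaces is a *uniform embedding* if it is injective and uniformly continuous and its inverse, defined on its image, is uniformly continuous. **Theorem.** Let $X$ be a Banach space, let $Y$ be a superstable Banach space, and suppose that there is a map $f\colon X\to Y$ that is both uniformly continuous and almost uncollapsed. Then the closed unit ball $B_X$ of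 $X$ uniformly embeds into a superstable Banach space. In fact, there are a superstable Banach space $Z$ and a uniformly continuous map $F\colon X\to Z$ such that the restriction $F|_{B_X}$ is a uniform embedding whose inverse $F(B_X)\to B_X$ is Lipschitz, i.e. for some constant $K\ge 0$ one has $\|x-y\|\le K\|F(x)-F(y)\|$ for all $x,y\in B_X$. -/

import Mathlib

open Filter Topology
open scoped ENNReal

universe u v w

/-- A metric space `M` is stable if
`lim_{i,U} lim_{j,V} d (x i, y j) = lim_{j,V} lim_{i,U} d (x i, y j)` for all bounded sequences
`x`, `y` in `M` and all nonprincipal ultrafilters `U`, `V` on `ℕ`. All the limits exist, because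
the sequences are bounded; here `g i` and `a` are the inner and the outer limit of the left-hand
side, and `h j` and `b` those of the right-hand side. -/
def IsStableSpace (M : Type u) [MetricSpace M] : Prop :=
  ∀ x y : ℕ → M, Bornology.IsBounded (Set.range x) → Bornology.IsBounded (Set.range y) →
    ∀ U V : Ultrafilter ℕ, (∀ n : ℕ, U ≠ pure n) → (∀ n : ℕ, V ≠ pure n) →
      ∀ (g h : ℕ → ℝ) (a b : ℝ),
        (∀ i, Tendsto (fun j => dist (x i) (y j)) V (𝓝 (g i))) → Tendsto g U (𝓝 a) →
        (∀ j, Tendsto (fun i => dist (x i) (y j)) U (𝓝 (h j))) → Tendsto h V (𝓝 b) →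
        a = b

/-- `W` is finitely representable in `Y`: for every finite-dimensional subspace `E` of `W` and
every `ε > 0` there are a subspace `F` of `Y` and a linear isomorphism `T` of `E` onto `F` with
`‖T‖ * ‖T⁻¹‖ < 1 + ε`. -/
def IsFinitelyRepresentable (W : Type w) [NormedAddCommGroup W] [NormedSpace ℝ W]
    (Y : Type v) [NormedAddCommGroup Y] [NormedSpace ℝ Y] : Prop :=
  ∀ E : Submodule ℝ W, FiniteDimensional ℝ E → ∀ ε : ℝ, 0 < ε →
    ∃ (F : Submodule ℝ Y) (T : E ≃L[ℝ] F),
      ‖(T : E →L[ℝ] F)‖ * ‖(T.symm : F →L[ℝ] E)‖ < 1 + ε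

/-- `Y` is superstable: every Banach space `W` that is finitely representable in `Y` is stable.
The universe `w` of the spaces `W` does not matter: stability concerns the separable subspaces
of `W` only, and those have copies in every universe. -/
def IsSuperstable (Y : Type v) [NormedAddCommGroup Y] [NormedSpace ℝ Y] : Prop :=
  ∀ (W : Type w) [NormedAddCommGroup W] [NormedSpace ℝ W] [CompleteSpace W],
    IsFinitelyRepresentable W Y → IsStableSpace W

/-- The exact compression modulus `inf {‖f x - f y‖ : ‖x - y‖ = t}`, as an extended nonnegative
real number; the infimum of the empty set is `∞`. -/
noncomputable def exactCompressionModulus {X : Type u} {Y : Type v}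
    [NormedAddCommGroup X] [NormedAddCommGroup Y] (f : X → Y) (t : ℝ) : ℝ≥0∞ :=
  ⨅ (x : X) (y : X) (_ : ‖x - y‖ = t), ENNReal.ofReal ‖f x - f y‖

/-- `f` is almost uncollapsed: its exact compression modulus is positive at some `t > 0`. -/
def IsAlmostUncollapsed {X : Type u} {Y : Type v}
    [NormedAddCommGroup X] [NormedAddCommGroup Y] (f : X → Y) : Prop :=
  ∃ t : ℝ, 0 < t ∧ 0 < exactCompressionModulus f t

/-!
Finite representability of ultraproducts shows that in a superstable space the defect
`‖x - y‖ - ‖x‖ - ‖y‖` has no long ladders. By a Ramsey argument it therefore cannot shatter deep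
binary trees, and averaging over the branches of a tree turns this into a family of inequalities,
`DefectBound`, that are linear in norms. Linearity lets them pass to spaces of vector-valued
functions normed by a mean of the norm, to completions and to finitely representable spaces.
Conversely, `DefectBound` forces stability, since binary search in a ladder shatters a tree.

Let `m` be a translation-invariant mean on `X`. The completion `Z` of the bounded continuous
functions `g : X → Y` with the norm `m ‖g‖` is thus superstable. The map `x ↦ (z ↦ f (x + z) - f z)`
into `Z` is uniformly continuous, and the distance of its values at `x` and `y` depends only on
`x - y`. Summing along the multiples of `x - y`, up to the one of norm about `t`, shows that its
inverse is Lipschitz at small distances. It remains to rescale the unit ball.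
-/

open scoped BigOperators BoundedContinuousFunction

section Trees

variable {A B C E F : Type*}

/-- The sum of the costs `c` along the path `l` in the binary tree with node labels `b`. The label
of a node depends on the signs that lead to it, and the cost on that label and on the sign with
which the path leaves the node. -/
def pathSum [AddCommMonoid E] (c : Bool → B → E) : (List Bool → B) → List Bool → E
  | _, [] => 0
  | b, e :: l => c e (b []) + pathSum c (fun k => b (e :: k)) l

theorem expect_ofFn_succ (n : ℕ) (Ψ : List Bool → ℝ) :
    𝔼 s : Fin (n + 1) → Bool, Ψ (List.ofFn s) =
      (𝔼 s : Fin n → Bool, Ψ (true :: List.ofFn s) +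
        𝔼 s : Fin n → Bool, Ψ (false :: List.ofFn s)) / 2 := by
  calc 𝔼 s : Fin (n + 1) → Bool, Ψ (List.ofFn s)
      = 𝔼 p : Bool × (Fin n → Bool), Ψ (p.1 :: List.ofFn p.2) :=
        (Fintype.expect_equiv (Fin.consEquiv fun _ => Bool) _ _ fun p => by
          simp [Fin.consEquiv, List.ofFn_succ]).symm
    _ = 𝔼 e : Bool, 𝔼 s : Fin n → Bool, Ψ (e :: List.ofFn s) := by
        rw [← Finset.univ_product_univ, Finset.expect_product]
    _ = _ := by
        rw [Fintype.expect_eq_sum_div_card, Fintype.sum_bool, Fintype.card_bool, Nat.cast_ofNat]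

theorem pathSum_mono {c c' : Bool → B → ℝ} (h : ∀ e y, c e y ≤ c' e y) (b : List Bool → B)
    (l : List Bool) : pathSum c b l ≤ pathSum c' b l := by
  induction l generalizing b with
  | nil => exact le_rfl
  | cons e l ih => exact add_le_add (h _ _) (ih _)

theorem pathSum_const [AddCommMonoid E] (a : E) (b : List Bool → B) (l : List Bool) :
    pathSum (fun _ _ => a) b l = l.length • a := by
  induction l generalizing b with
  | nil => simp [pathSum]
  | cons e l ih => rw [pathSum, ih, List.length_cons, succ_nsmul']

theorem pathSum_add [AddCommMonoid E] (c c' : Bool → B → E) (b : List Bool → B) (l : List Bool) :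
    pathSum (fun e y => c e y + c' e y) b l = pathSum c b l + pathSum c' b l := by
  induction l generalizing b with
  | nil => simp [pathSum]
  | cons e l ih => simp only [pathSum, ih, add_add_add_comm]

theorem map_pathSum {Φ : Type*} [AddCommMonoid E] [AddCommMonoid F] [FunLike Φ E F]
    [AddMonoidHomClass Φ E F] (T : Φ) (c : Bool → B → E) (b : List Bool → B) (l : List Bool) :
    T (pathSum c b l) = pathSum (fun e y => T (c e y)) b l := by
  induction l generalizing b with
  | nil => exact map_zero T
  | cons e l ih => simp only [pathSum, map_add, ih]

theorem mul_pathSum (a : ℝ) (c : Bool → B → ℝ) (b : List Bool → B) (l : List Bool) :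
    a * pathSum c b l = pathSum (fun e y => a * c e y) b l :=
  map_pathSum (AddMonoidHom.mulLeft a) c b l

theorem pathSum_sum {ι : Type*} (s : Finset ι) (c : ι → Bool → B → ℝ) (b : List Bool → B)
    (l : List Bool) :
    pathSum (fun e y => ∑ k ∈ s, c k e y) b l = ∑ k ∈ s, pathSum (c k) b l := by
  induction l generalizing b with
  | nil => simp [pathSum]
  | cons e l ih => simp only [pathSum, ih, Finset.sum_add_distrib]

theorem pathSum_comp [AddCommMonoid E] (c : Bool → C → E) (g : B → C) (b : List Bool → B)
    (l : List Bool) :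
    pathSum c (fun k => g (b k)) l = pathSum (fun e y => c e (g y)) b l := by
  induction l generalizing b with
  | nil => rfl
  | cons e l ih => simp only [pathSum, ih]

theorem pathSum_nonneg {c : Bool → B → ℝ} (h : ∀ e y, 0 ≤ c e y) (b : List Bool → B)
    (l : List Bool) : 0 ≤ pathSum c b l := by
  simpa [pathSum_const] using pathSum_mono h b l

/-- The sign `1` or `-1` that belongs to a Boolean. -/
def boolSign (e : Bool) : ℝ := if e then 1 else -1

@[simp] theorem boolSign_true : boolSign true = 1 := rfl
@[simp] theorem boolSign_false : boolSign false = -1 := rfl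

theorem boolSign_mul_le_abs (e : Bool) (a : ℝ) : boolSign e * a ≤ |a| := by
  cases e <;> simp [le_abs_self, neg_le_abs]

theorem expect_pathSum_boolSign_mul (n : ℕ) (g : B → ℝ) (b : List Bool → B) :
    𝔼 s : Fin n → Bool, pathSum (fun e y => boolSign e * g y) b (List.ofFn s) = 0 := by
  induction n generalizing b with
  | zero => simp [pathSum]
  | succ n ih =>
    rw [expect_ofFn_succ]
    simp only [pathSum, Finset.expect_add_distrib, Fintype.expect_const, ih]
    simp

end Trees

section Shattering

variable {A P : Type*}

/-- `G` is shattered to depth `n` by a binary tree of queries in `H`: every path of the tree, which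
at a query `p` turns to `low p` or to `high p`, is followed by some point of `G`. -/
def Shatters (low high : P → Set A) : ℕ → Set A → Set P → Prop
  | 0, G, _ => G.Nonempty
  | n + 1, G, H => ∃ p ∈ H, Shatters low high n (G ∩ low p) H ∧ Shatters low high n (G ∩ high p) H

namespace Shatters

variable {low high : P → Set A}

theorem mono {n : ℕ} {G G' : Set A} {H H' : Set P} (h : Shatters low high n G H) (hG : G ⊆ G')
    (hH : H ⊆ H') : Shatters low high n G' H' := by
  induction n generalizing G G' with
  | zero => exact Set.Nonempty.mono hG h
  | succ n ih =>
    obtain ⟨p, hp, hlow, hhigh⟩ := h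
    exact ⟨p, hH hp, ih hlow (Set.inter_subset_inter_left _ hG),
      ih hhigh (Set.inter_subset_inter_left _ hG)⟩

theorem nonempty {n : ℕ} {G : Set A} {H : Set P} (h : Shatters low high n G H) : G.Nonempty := by
  induction n generalizing G with
  | zero => exact h
  | succ n ih =>
    obtain ⟨p, -, hlow, -⟩ := h
    exact (ih hlow).mono Set.inter_subset_left

-- The Ramsey property of binary trees whose nodes have two colours.
theorem of_union {m n : ℕ} {G : Set A} {H H' : Set P}
    (h : Shatters low high (m + n) G (H ∪ H')) :
    Shatters low high m G H ∨ Shatters low high n G H' := by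
  induction hk : m + n generalizing m n G with
  | zero =>
    obtain ⟨rfl, rfl⟩ : m = 0 ∧ n = 0 := by omega
    exact Or.inl h.nonempty
  | succ k ih =>
    rcases m with _ | m
    · exact Or.inl h.nonempty
    rcases n with _ | n
    · exact Or.inr h.nonempty
    rw [hk] at h
    obtain ⟨p, hp, hlow, hhigh⟩ := h
    have restrict {j : ℕ} {S : Set A} {L : Set P} (hS : Shatters low high j (G ∩ S) L) :
        Shatters low high j G L := hS.mono Set.inter_subset_left le_rfl
    rcases hp with hp | hp
    · have e : m + (n + 1) = k := by omega
      rcases ih (e ▸ hlow) e with hlow | hlow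
      · exact (ih (e ▸ hhigh) e).imp (fun hhigh => ⟨p, hp, hlow, hhigh⟩) restrict
      · exact Or.inr (restrict hlow)
    · have e : (m + 1) + n = k := by omega
      rcases ih (e ▸ hlow) e with hlow | hlow
      · exact Or.inl (restrict hlow)
      · exact (ih (e ▸ hhigh) e).imp restrict (fun hhigh => ⟨p, hp, hlow, hhigh⟩)

theorem exists_tree [Nonempty P] {n : ℕ} {G : Set A} {H : Set P} (h : Shatters low high n G H)
    {c : Bool → A → P → ℝ} {d : Bool → P → ℝ}
    (hlow : ∀ p ∈ H, ∀ x ∈ G, x ∈ low p → d false p ≤ c false x p)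
    (hhigh : ∀ p ∈ H, ∀ x ∈ G, x ∈ high p → d true p ≤ c true x p) :
    ∃ (b : List Bool → P) (x : List Bool → A), ∀ l, l.length = n →
      x l ∈ G ∧ pathSum d b l ≤ pathSum (fun e => c e (x l)) b l := by
  induction n generalizing G with
  | zero =>
    obtain ⟨x, hx⟩ := h
    refine ⟨fun _ => Classical.arbitrary P, fun _ => x, fun l hl => ⟨hx, ?_⟩⟩
    rw [List.length_eq_zero_iff.1 hl]
    exact le_rfl
  | succ n ih =>
    obtain ⟨p, hp, h₀, h₁⟩ := h
    obtain ⟨b₀, x₀, hx₀⟩ := ih h₀ (fun q hq x hx => hlow q hq x hx.1)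
      (fun q hq x hx => hhigh q hq x hx.1)
    obtain ⟨b₁, x₁, hx₁⟩ := ih h₁ (fun q hq x hx => hlow q hq x hx.1)
      (fun q hq x hx => hhigh q hq x hx.1)
    refine ⟨fun l => match l with
        | [] => p
        | false :: l => b₀ l
        | true :: l => b₁ l,
      fun l => match l with
        | [] => x₀ []
        | false :: l => x₀ l
        | true :: l => x₁ l, ?_⟩
    rintro (_ | ⟨_ | _, l⟩) hl
    · simp at hl
    · obtain ⟨hG, hle⟩ := hx₀ l (by simpa using hl)
      exact ⟨hG.1, add_le_add (hlow p hp _ hG.1 hG.2) hle⟩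
    · obtain ⟨hG, hle⟩ := hx₁ l (by simpa using hl)
      exact ⟨hG.1, add_le_add (hhigh p hp _ hG.1 hG.2) hle⟩

end Shatters

/-- A ladder of length `n` in `G` and `H`: the relation `S` holds on and above the diagonal and the
relation `R` below it. -/
def HasLadder (S R : P → Set A) (n : ℕ) (G : Set A) (H : Set P) : Prop :=
  ∃ (x : ℕ → A) (p : ℕ → P), (∀ i < n, x i ∈ G ∧ p i ∈ H) ∧
    ∀ i < n, ∀ j < n, (i ≤ j → x i ∈ S (p j)) ∧ (j < i → x i ∈ R (p j))

namespace HasLadder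

variable {S R : P → Set A} {n : ℕ} {G : Set A} {H : Set P}

theorem mono {G' : Set A} {H' : Set P} (h : HasLadder S R n G H) (hG : G ⊆ G') (hH : H ⊆ H') :
    HasLadder S R n G' H' := by
  obtain ⟨x, p, hmem, hrel⟩ := h
  exact ⟨x, p, fun i hi => ⟨hG (hmem i hi).1, hH (hmem i hi).2⟩, hrel⟩

theorem zero [Nonempty A] [Nonempty P] : HasLadder S R 0 G H :=
  ⟨fun _ => Classical.arbitrary A, fun _ => Classical.arbitrary P, by simp, by simp⟩

theorem cons {x : A} {p : P} (hx : x ∈ G) (hp : p ∈ H) (hxp : x ∈ S p)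
    (h : HasLadder S R n (G ∩ R p) (H ∩ {q | x ∈ S q})) : HasLadder S R (n + 1) G H := by
  obtain ⟨X, Q, hmem, hrel⟩ := h
  refine ⟨fun n => Nat.casesOn n x X, fun n => Nat.casesOn n p Q, ?_, ?_⟩
  · rintro (_ | i) hi
    · exact ⟨hx, hp⟩
    · exact ⟨(hmem i (by omega)).1.1, (hmem i (by omega)).2.1⟩
  · rintro (_ | i) hi (_ | j) hj
    · exact ⟨fun _ => hxp, fun h => absurd h (lt_irrefl _)⟩
    · exact ⟨fun _ => (hmem j (by omega)).2.2, fun h => absurd h (by omega)⟩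
    · exact ⟨fun h => absurd h (by omega), fun _ => (hmem i (by omega)).1.2⟩
    · have := hrel i (by omega) j (by omega)
      exact ⟨fun h => this.1 (by omega), fun h => this.2 (by omega)⟩

theorem of_eventually {I J : Type*} {U : Filter I} {V : Filter J} [U.NeBot] [V.NeBot] {x : I → A}
    {p : J → P} (hx : ∀ᶠ i in U, x i ∈ G) (hp : ∀ᶠ j in V, p j ∈ H)
    (hS : ∀ᶠ i in U, ∀ᶠ j in V, x i ∈ S (p j)) (hR : ∀ᶠ j in V, ∀ᶠ i in U, x i ∈ R (p j))
    (n : ℕ) : HasLadder S R n G H := by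
  obtain ⟨i₀⟩ := U.nonempty_of_neBot
  obtain ⟨j₀⟩ := V.nonempty_of_neBot
  have : Nonempty A := ⟨x i₀⟩
  have : Nonempty P := ⟨p j₀⟩
  induction n generalizing G H with
  | zero => exact zero
  | succ n ih =>
    obtain ⟨i, hiG, hiS⟩ := (hx.and hS).exists
    obtain ⟨j, ⟨hjH, hjR⟩, hij⟩ := ((hp.and hR).and hiS).exists
    exact cons hiG hjH hij (ih (hx.and hjR) (hp.and hiS))

theorem exists_split {m k : ℕ} (hm : 0 < m) (h : HasLadder S R (m + k) G H) :
    ∃ p ∈ H, HasLadder S R m (G ∩ S p) H ∧ HasLadder S R k (G ∩ R p) H := by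
  obtain ⟨x, p, hmem, hrel⟩ := h
  refine ⟨p (m - 1), (hmem _ (by omega)).2, ⟨x, p, fun i hi => ?_, fun i hi j hj => ?_⟩,
    ⟨fun i => x (m + i), fun j => p (m + j), fun i hi => ?_, fun i hi j hj => ?_⟩⟩
  · exact ⟨⟨(hmem i (by omega)).1, (hrel i (by omega) (m - 1) (by omega)).1 (by omega)⟩,
      (hmem i (by omega)).2⟩
  · exact hrel i (by omega) j (by omega)
  · exact ⟨⟨(hmem _ (by omega)).1, (hrel (m + i) (by omega) (m - 1) (by omega)).2 (by omega)⟩,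
      (hmem _ (by omega)).2⟩
  · have := hrel (m + i) (by omega) (m + j) (by omega)
    exact ⟨fun h => this.1 (by omega), fun h => this.2 (by omega)⟩

theorem exists_seq (h : HasLadder S R (n + 1) G H) :
    ∃ (x : ℕ → A) (p : ℕ → P), (∀ i, x i ∈ G) ∧ (∀ j, p j ∈ H) ∧
      ∀ j < n, (∀ i ≤ j, x i ∈ S (p j)) ∧ ∀ i > j, x i ∈ R (p j) := by
  obtain ⟨x, p, hmem, hrel⟩ := h
  refine ⟨fun i => x (min i n), fun j => p (min j n), fun i => (hmem _ (by omega)).1,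
    fun j => (hmem _ (by omega)).2, fun j hj => ⟨fun i hi => ?_, fun i hi => ?_⟩⟩
  · exact (hrel _ (by omega) _ (by omega)).1 (by omega)
  · exact (hrel _ (by omega) _ (by omega)).2 (by omega)

-- Binary search in the ladder.
theorem shatters (h : HasLadder S R (2 ^ n) G H) : Shatters S R n G H := by
  induction n generalizing G with
  | zero =>
    obtain ⟨x, _, hmem, -⟩ := h
    exact ⟨x 0, (hmem 0 one_pos).1⟩
  | succ n ih =>
    rw [pow_succ, mul_two] at h
    obtain ⟨p, hp, hS, hR⟩ := h.exists_split (by positivity)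
    exact ⟨p, hp, ih hS, ih hR⟩

end HasLadder

theorem exists_hasLadder_of_shatters [Nonempty A] [Nonempty P] (low high mid : P → Set A)
    (a b : ℕ) : ∃ K, ∀ G H, Shatters low high K G H →
      HasLadder mid low a G H ∨ HasLadder (fun p => (mid p)ᶜ) high b G H := by
  induction hk : a + b generalizing a b with
  | zero =>
    obtain ⟨rfl, rfl⟩ : a = 0 ∧ b = 0 := by omega
    exact ⟨0, fun G H _ => Or.inl HasLadder.zero⟩
  | succ k ih =>
    rcases a with _ | a
    · exact ⟨0, fun G H _ => Or.inl HasLadder.zero⟩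
    rcases b with _ | b
    · exact ⟨0, fun G H _ => Or.inr HasLadder.zero⟩
    obtain ⟨K₁, h₁⟩ := ih a (b + 1) (by omega)
    obtain ⟨K₂, h₂⟩ := ih (a + 1) b (by omega)
    refine ⟨(K₁ + 1) + (K₂ + 1), fun G H hs => ?_⟩
    -- Any point of `G` colours the queries, and one colour carries a deep tree.
    obtain ⟨x, hx⟩ := hs.nonempty
    rw [← Set.inter_union_compl H {q | x ∈ mid q}] at hs
    rcases hs.of_union with ⟨p, hp, hl, -⟩ | ⟨p, hp, -, hr⟩
    · exact (h₁ _ _ hl).imp (HasLadder.cons hx hp.1 hp.2)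
        (·.mono Set.inter_subset_left Set.inter_subset_left)
    · exact (h₂ _ _ hr).imp (·.mono Set.inter_subset_left Set.inter_subset_left)
        (HasLadder.cons hx hp.1 hp.2)

end Shattering

section Moments

variable {A B : Type*}

/-- The `w`-weighted mean, over all paths of length `n`, of the exponential of the path sum: the
costs of a path may depend on the label `x` of the leaf at its end, and so does the weight. -/
noncomputable def expMoment (c : Bool → A → B → ℝ) (n : ℕ) (w : A → ℝ) (b : List Bool → B)
    (x : List Bool → A) : ℝ :=
  𝔼 s : Fin n → Bool, w (x (List.ofFn s)) *
    Real.exp (pathSum (fun e => c e (x (List.ofFn s))) b (List.ofFn s))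

variable {c : Bool → A → B → ℝ} {n : ℕ} {b : List Bool → B} {x : List Bool → A}

theorem expMoment_mono {w w' : A → ℝ} (h : w ≤ w') :
    expMoment c n w b x ≤ expMoment c n w' b x :=
  Finset.expect_le_expect fun _ _ => mul_le_mul_of_nonneg_right (h _) (Real.exp_pos _).le

theorem expMoment_add (w w' : A → ℝ) :
    expMoment c n (w + w') b x = expMoment c n w b x + expMoment c n w' b x := by
  simp only [expMoment, Pi.add_apply, add_mul, Finset.expect_add_distrib]

theorem expMoment_smul (a : ℝ) (w : A → ℝ) :
    expMoment c n (a • w) b x = a * expMoment c n w b x := by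
  simp only [expMoment, Pi.smul_apply, smul_eq_mul, mul_assoc, Finset.mul_expect]

theorem expMoment_succ (w : A → ℝ) :
    expMoment c (n + 1) w b x =
      (expMoment c n (fun z => w z * Real.exp (c true z (b []))) (fun l => b (true :: l))
          (fun l => x (true :: l)) +
        expMoment c n (fun z => w z * Real.exp (c false z (b []))) (fun l => b (false :: l))
          (fun l => x (false :: l))) / 2 := by
  unfold expMoment
  rw [expect_ofFn_succ n fun l => w (x l) * Real.exp (pathSum (fun e => c e (x l)) b l)]
  simp only [pathSum, Real.exp_add, mul_assoc]

/-- The points whose value at `p.1` is at most `p.2`. -/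
def sublevel (φ : A → B → ℝ) (p : B × ℝ) : Set A := {x | φ x p.1 ≤ p.2}

/-- The points whose value at `p.1` is at least `p.2 + δ`. -/
def superlevel (φ : A → B → ℝ) (δ : ℝ) (p : B × ℝ) : Set A := {x | p.2 + δ ≤ φ x p.1}

theorem exists_split_of_not_shatters {φ : A → B → ℝ} {D δ : ℝ} (hD : 0 ≤ D) (hδ : 0 < δ) {r : ℕ}
    {G : Set A} {S : Set B} {y : B} (hy : y ∈ S) (hφ : ∀ x ∈ G, |φ x y| ≤ D)
    (hr : ¬ Shatters (sublevel φ) (superlevel φ δ) (r + 1) G (Prod.fst ⁻¹' S)) :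
    ∃ m, |m| ≤ D ∧
      ¬ Shatters (sublevel φ) (superlevel φ δ) r (G ∩ {x | φ x y ≤ m - δ}) (Prod.fst ⁻¹' S) ∧
      ¬ Shatters (sublevel φ) (superlevel φ δ) r (G ∩ {x | m + δ ≤ φ x y}) (Prod.fst ⁻¹' S) := by
  by_cases hG : Shatters (sublevel φ) (superlevel φ δ) r G (Prod.fst ⁻¹' S)
  swap
  · exact ⟨0, by simpa using hD, fun h => hG (h.mono Set.inter_subset_left le_rfl),
      fun h => hG (h.mono Set.inter_subset_left le_rfl)⟩
  let s (k : ℕ) : ℝ := -D + k * δ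
  -- The last threshold of this form above which `φ · y` still shatters.
  obtain ⟨k, hk, hk'⟩ := Nat.exists_not_and_succ_of_not_zero_of_exists
    (p := fun k => ¬ Shatters (sublevel φ) (superlevel φ δ) r (G ∩ {x | s k ≤ φ x y})
      (Prod.fst ⁻¹' S))
    (not_not.2 (hG.mono (fun x hx => ⟨hx, by simpa [s] using neg_le_of_abs_le (hφ x hx)⟩) le_rfl))
    (by
      obtain ⟨k, hk⟩ := exists_nat_gt ((D + D) / δ)
      refine ⟨k, fun h => ?_⟩
      obtain ⟨x, hxG, hx⟩ := h.nonempty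
      rw [div_lt_iff₀ hδ] at hk
      have hx : -D + k * δ ≤ φ x y := hx
      linarith [le_of_abs_le (hφ x hxG)])
  rw [not_not] at hk
  have hs : s (k + 1) = s k + δ := by simp only [s]; push_cast; ring
  refine ⟨s k, abs_le.2 ⟨?_, ?_⟩, fun h => hr ⟨(y, s k - δ), hy, h, ?_⟩, hs ▸ hk'⟩
  · have : 0 ≤ k * δ := by positivity
    simp only [s]
    linarith
  · obtain ⟨x, hxG, hx⟩ := hk.nonempty
    exact le_trans hx (le_of_abs_le (hφ x hxG))
  · simpa only [superlevel, sub_add_cancel] using hk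

theorem indicator_one_nonneg (G : Set A) (x : A) : 0 ≤ G.indicator (1 : A → ℝ) x :=
  Set.indicator_nonneg (fun _ _ => zero_le_one) x

theorem indicator_mul_exp_le {e : Bool} {φ c : A → ℝ} {G : Set A} {D η t m : ℝ} (ht : 0 ≤ t)
    (hη : 0 ≤ η) (hφ : ∀ z ∈ G, |φ z| ≤ D) (hc : ∀ z ∈ G, c z ≤ boolSign e * φ z - η) :
    (fun z => G.indicator 1 z * Real.exp (t * c z)) ≤
      Real.exp (t * D) • ((G ∩ {z | φ z ≤ m - η / 2}).indicator 1 +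
        (G ∩ {z | m + η / 2 ≤ φ z}).indicator 1) +
      Real.exp (t * (boolSign e * m - η / 2)) • (G ∩ {z | |φ z - m| ≤ η / 2}).indicator 1 := by
  intro z
  set lo := (G ∩ {z | φ z ≤ m - η / 2}).indicator (1 : A → ℝ) z
  set hi := (G ∩ {z | m + η / 2 ≤ φ z}).indicator (1 : A → ℝ) z
  set mid := (G ∩ {z | |φ z - m| ≤ η / 2}).indicator (1 : A → ℝ) z
  have lo_nonneg : 0 ≤ lo := indicator_one_nonneg _ z
  have hi_nonneg : 0 ≤ hi := indicator_one_nonneg _ z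
  have mid_nonneg : 0 ≤ mid := indicator_one_nonneg _ z
  change G.indicator 1 z * Real.exp (t * c z) ≤
    Real.exp (t * D) * (lo + hi) + Real.exp (t * (boolSign e * m - η / 2)) * mid
  by_cases hz : z ∈ G
  swap
  · rw [Set.indicator_of_notMem hz, zero_mul]
    positivity
  have hcD : Real.exp (t * c z) ≤ Real.exp (t * D) := by
    gcongr
    linarith [hc z hz, boolSign_mul_le_abs e (φ z), hφ z hz]
  rw [Set.indicator_of_mem hz, Pi.one_apply, one_mul]
  rcases le_or_gt |φ z - m| (η / 2) with hm | hm
  · have hcm : Real.exp (t * c z) ≤ Real.exp (t * (boolSign e * m - η / 2)) := by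
      gcongr
      linarith [hc z hz, boolSign_mul_le_abs e (φ z - m)]
    have : mid = 1 := Set.indicator_of_mem (s := G ∩ {z | |φ z - m| ≤ η / 2}) ⟨hz, hm⟩ 1
    rw [this, mul_one]
    exact hcm.trans (le_add_of_nonneg_left (by positivity))
  · have : 1 ≤ lo + hi := by
      rcases lt_abs.1 hm with hm | hm
      · have : hi = 1 :=
          Set.indicator_of_mem (s := G ∩ {z | m + η / 2 ≤ φ z}) ⟨hz, by simp; linarith⟩ 1
        linarith
      · have : lo = 1 :=
          Set.indicator_of_mem (s := G ∩ {z | φ z ≤ m - η / 2}) ⟨hz, by simp; linarith⟩ 1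
        linarith
    calc Real.exp (t * c z) ≤ Real.exp (t * D) * 1 := by rwa [mul_one]
      _ ≤ Real.exp (t * D) * (lo + hi) := by gcongr
      _ ≤ _ := le_add_of_nonneg_right (by positivity)

theorem exp_add_exp_neg_mul_exp_le {a s : ℝ} (h : a ^ 2 / 2 ≤ s) :
    (Real.exp (a - s) + Real.exp (-a - s)) / 2 ≤ 1 := by
  calc (Real.exp (a - s) + Real.exp (-a - s)) / 2 = Real.cosh a / Real.exp s := by
        rw [Real.cosh_eq, Real.exp_sub, Real.exp_sub]
        ring
    _ ≤ Real.exp (a ^ 2 / 2) / Real.exp s := by gcongr; exact Real.cosh_le_exp_half_sq a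
    _ ≤ 1 := (div_le_one (Real.exp_pos s)).2 (Real.exp_le_exp.2 h)

theorem one_add_mul_pow_recursion {κ : ℝ} (hκ : 0 ≤ κ) (n r : ℕ) :
    κ * (1 + κ * n) ^ r + (1 + κ * n) ^ (r + 1) ≤ (1 + κ * (n + 1 : ℕ)) ^ (r + 1) := by
  calc κ * (1 + κ * n) ^ r + (1 + κ * n) ^ (r + 1)
      = (1 + κ * n) ^ r * (1 + κ * (n + 1 : ℕ)) := by push_cast; ring
    _ ≤ (1 + κ * (n + 1 : ℕ)) ^ r * (1 + κ * (n + 1 : ℕ)) := by gcongr; simp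
    _ = _ := (pow_succ _ _).symm

theorem expMoment_succ_le_of_split {φ : A → ℝ} {D η t m u v : ℝ} {G : Set A} (ht : 0 ≤ t)
    (hη : 0 ≤ η) (htη : t * D ^ 2 = η) (hm : |m| ≤ D) (hv : 0 ≤ v) (hφ : ∀ z ∈ G, |φ z| ≤ D)
    (hc : ∀ e, ∀ z ∈ G, c e z (b []) ≤ boolSign e * φ z - η)
    (hlo : ∀ b x, expMoment (fun e x y => t * c e x y) n
      ((G ∩ {z | φ z ≤ m - η / 2}).indicator 1) b x ≤ u)
    (hhi : ∀ b x, expMoment (fun e x y => t * c e x y) n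
      ((G ∩ {z | m + η / 2 ≤ φ z}).indicator 1) b x ≤ u)
    (hmid : ∀ b x, expMoment (fun e x y => t * c e x y) n
      ((G ∩ {z | |φ z - m| ≤ η / 2}).indicator 1) b x ≤ v) :
    expMoment (fun e x y => t * c e x y) (n + 1) (G.indicator 1) b x ≤
      2 * Real.exp (t * D) * u + v := by
  have hstep (e : Bool) (b' : List Bool → B) (x' : List Bool → A) :
      expMoment (fun e x y => t * c e x y) n
          (fun z => G.indicator 1 z * Real.exp (t * c e z (b []))) b' x' ≤
        2 * Real.exp (t * D) * u + Real.exp (t * (boolSign e * m - η / 2)) * v := by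
    refine (expMoment_mono (indicator_mul_exp_le (m := m) ht hη hφ (hc e))).trans ?_
    rw [expMoment_add, expMoment_smul, expMoment_smul, expMoment_add, mul_comm 2, mul_assoc,
      two_mul]
    gcongr
    exacts [hlo b' x', hhi b' x', hmid b' x']
  have hmsq : (t * m) ^ 2 / 2 ≤ t * (η / 2) := by
    have : m ^ 2 ≤ D ^ 2 := sq_le_sq' (neg_le_of_abs_le hm) (le_of_abs_le hm)
    calc (t * m) ^ 2 / 2 = t * (t * m ^ 2) / 2 := by ring
      _ ≤ t * (t * D ^ 2) / 2 := by gcongr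
      _ = t * (η / 2) := by rw [htη]; ring
  have hcosh : (Real.exp (t * (boolSign true * m - η / 2)) +
      Real.exp (t * (boolSign false * m - η / 2))) / 2 ≤ 1 := by
    convert exp_add_exp_neg_mul_exp_le hmsq using 5 <;> simp <;> ring
  rw [expMoment_succ]
  linarith [hstep true (fun l => b (true :: l)) (fun l => x (true :: l)),
    hstep false (fun l => b (false :: l)) (fun l => x (false :: l)),
    mul_le_mul_of_nonneg_right hcosh hv]

theorem expMoment_succ_le_of_nonpos {t v : ℝ} {G : Set A} (ht : 0 ≤ t)
    (hc : ∀ e, ∀ z ∈ G, c e z (b []) ≤ 0)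
    (hG : ∀ b x, expMoment (fun e x y => t * c e x y) n (G.indicator 1) b x ≤ v) :
    expMoment (fun e x y => t * c e x y) (n + 1) (G.indicator 1) b x ≤ v := by
  have hw (e : Bool) :
      (fun z => G.indicator 1 z * Real.exp (t * c e z (b []))) ≤ G.indicator 1 := by
    intro z
    by_cases hz : z ∈ G
    · simpa [hz] using mul_nonpos_of_nonneg_of_nonpos ht (hc e z hz)
    · simp [hz]
  have hstep (e : Bool) (b' : List Bool → B) (x' : List Bool → A) :=
    (expMoment_mono (hw e)).trans (hG b' x')
  rw [expMoment_succ]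
  linarith [hstep true (fun l => b (true :: l)) (fun l => x (true :: l)),
    hstep false (fun l => b (false :: l)) (fun l => x (false :: l))]

theorem expMoment_le {φ : A → B → ℝ} {D η : ℝ} (hD : 0 < D) (hη : 0 < η) {S : Set B} {r : ℕ}
    {G : Set A} (hφ : ∀ x ∈ G, ∀ y ∈ S, |φ x y| ≤ D)
    (hS : ∀ e, ∀ x ∈ G, ∀ y ∈ S, c e x y ≤ boolSign e * φ x y - η)
    (hS' : ∀ e, ∀ x ∈ G, ∀ y ∉ S, c e x y ≤ 0)
    (hr : ¬ Shatters (sublevel φ) (superlevel φ (η / 2)) r G (Prod.fst ⁻¹' S)) :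
    expMoment (fun e x y => η / D ^ 2 * c e x y) n (G.indicator 1) b x ≤
      (1 + 2 * Real.exp (η / D) * n) ^ r := by
  set κ := 2 * Real.exp (η / D) with hκ
  have hκ0 : 0 ≤ κ := by positivity
  have ht : 0 ≤ η / D ^ 2 := by positivity
  have htD : η / D ^ 2 * D = η / D := by field_simp
  induction n generalizing r G b x with
  | zero =>
    simpa [expMoment, pathSum] using
      Set.indicator_le_self' (f := (1 : A → ℝ)) (s := G) (fun _ _ => zero_le_one) (x [])
  | succ n ih =>
    have ih_sub {r : ℕ} {G' : Set A} (hG' : G' ⊆ G)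
        (hr : ¬ Shatters (sublevel φ) (superlevel φ (η / 2)) r G' (Prod.fst ⁻¹' S))
        (b : List Bool → B) (x : List Bool → A) :
        expMoment (fun e x y => η / D ^ 2 * c e x y) n (G'.indicator 1) b x ≤ (1 + κ * n) ^ r :=
      ih (fun x hx => hφ x (hG' hx)) (fun e x hx => hS e x (hG' hx))
        (fun e x hx => hS' e x (hG' hx)) hr
    rcases r with _ | r
    · have : G = ∅ := Set.not_nonempty_iff_eq_empty.1 hr
      simp [expMoment, this]
    refine le_trans ?_ (one_add_mul_pow_recursion hκ0 n r)
    by_cases hy : b [] ∈ S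
    · obtain ⟨m, hm, hlo, hhi⟩ := exists_split_of_not_shatters hD.le (half_pos hη) hy
        (fun x hx => hφ x hx _ hy) hr
      rw [hκ, ← htD]
      exact expMoment_succ_le_of_split ht hη.le (by field_simp) hm (by positivity)
        (fun x hx => hφ x hx _ hy) (fun e x hx => hS e x hx _ hy)
        (htD ▸ ih_sub Set.inter_subset_left hlo) (htD ▸ ih_sub Set.inter_subset_left hhi)
        (htD ▸ ih_sub Set.inter_subset_left fun h => hr (h.mono Set.inter_subset_left le_rfl))
    · exact (expMoment_succ_le_of_nonpos ht (fun e x hx => hS' e x hx _ hy)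
        (ih_sub le_rfl hr)).trans (le_add_of_nonneg_left (by positivity))

end Moments

section Excess

variable {A B : Type*} {c : Bool → A → B → ℝ} {G : Set A} {n : ℕ} {a : ℝ} {b : List Bool → B}
  {x : List Bool → A}

/-- The mean, over all paths of length `n` to leaves with labels in `G`, of the amount by which the
path sum exceeds `a`. -/
noncomputable def meanExcess (c : Bool → A → B → ℝ) (G : Set A) (a : ℝ) (n : ℕ)
    (b : List Bool → B) (x : List Bool → A) : ℝ :=
  𝔼 s : Fin n → Bool, G.indicator 1 (x (List.ofFn s)) *
    max 0 (pathSum (fun e => c e (x (List.ofFn s))) b (List.ofFn s) - a)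

theorem max_zero_le_exp_div {t u : ℝ} (ht : 0 < t) : max 0 u ≤ Real.exp (t * u) / t := by
  rw [le_div_iff₀ ht]
  rcases max_cases 0 u with ⟨h, -⟩ | ⟨h, -⟩ <;> rw [h]
  · simpa using (Real.exp_pos _).le
  · linarith [Real.add_one_le_exp (t * u)]

theorem meanExcess_le_expMoment {t : ℝ} (ht : 0 < t) :
    meanExcess c G a n b x ≤
      Real.exp (-(t * a)) / t * expMoment (fun e x y => t * c e x y) n (G.indicator 1) b x := by
  rw [expMoment, Finset.mul_expect]
  refine Finset.expect_le_expect fun s _ => ?_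
  refine (mul_le_mul_of_nonneg_left (max_zero_le_exp_div ht)
    (indicator_one_nonneg _ _)).trans_eq ?_
  rw [← mul_pathSum, mul_sub, sub_eq_add_neg, Real.exp_add]
  ring

theorem meanExcess_succ_le_of_nonpos {v : Bool → ℝ} (hc : ∀ e, ∀ z ∈ G, c e z (b []) ≤ 0)
    (hv : ∀ e, meanExcess c G a n (fun l => b (e :: l)) (fun l => x (e :: l)) ≤ v e) :
    meanExcess c G a (n + 1) b x ≤ (v true + v false) / 2 := by
  have hstep (e : Bool) : 𝔼 s : Fin n → Bool, G.indicator 1 (x (e :: List.ofFn s)) *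
      max 0 (pathSum (fun e' => c e' (x (e :: List.ofFn s))) b (e :: List.ofFn s) - a) ≤ v e := by
    refine le_trans (Finset.expect_le_expect fun s _ => ?_) (hv e)
    by_cases hz : x (e :: List.ofFn s) ∈ G
    · refine mul_le_mul_of_nonneg_left (max_le_max le_rfl ?_) (indicator_one_nonneg _ _)
      simpa only [pathSum, sub_le_sub_iff_right] using add_le_of_nonpos_left (hc e _ hz)
    · simp [hz]
  rw [meanExcess, expect_ofFn_succ n fun l => G.indicator 1 (x l) *
    max 0 (pathSum (fun e => c e (x l)) b l - a)]
  linarith [hstep true, hstep false]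

theorem meanExcess_le_mul_expect {T : Set B} {K : ℝ} {N : ℕ} (ha : 0 ≤ a) (hK : 0 ≤ K)
    (hc : ∀ e, ∀ z ∈ G, ∀ y ∉ T, c e z y ≤ 0)
    (hbound : ∀ n ≤ N, ∀ b x, meanExcess c G a n b x ≤ K) (hn : n ≤ N) :
    meanExcess c G a n b x ≤
      K * 𝔼 s : Fin n → Bool, pathSum (fun _ => T.indicator 1) b (List.ofFn s) := by
  induction n generalizing b x with
  | zero => simp [meanExcess, pathSum, ha]
  | succ n ih =>
    rw [expect_ofFn_succ n fun l => pathSum (fun _ => T.indicator 1) b l]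
    by_cases hy : b [] ∈ T
    · have hone (e : Bool) : 1 ≤ 𝔼 s : Fin n → Bool,
          pathSum (fun _ => T.indicator (1 : B → ℝ)) b (e :: List.ofFn s) := by
        refine Finset.le_expect Finset.univ_nonempty fun s _ => ?_
        simpa [pathSum, hy] using
          pathSum_nonneg (fun _ y => indicator_one_nonneg T y) (fun k => b (e :: k)) (List.ofFn s)
      calc _ ≤ K * 1 := (hbound _ hn b x).trans_eq (mul_one K).symm
        _ ≤ _ := by gcongr; linarith [hone true, hone false]
    · refine (meanExcess_succ_le_of_nonpos (fun e z hz => hc e z hz _ hy)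
        fun e => ih (by omega)).trans_eq ?_
      simp only [pathSum, Set.indicator_of_notMem hy, zero_add]
      ring

end Excess

section Defect

variable {V : Type*} [SeminormedAddCommGroup V]

/-- The defect of the triangle inequality. -/
def normDefect (x y : V) : ℝ := ‖x - y‖ - ‖x‖ - ‖y‖

theorem normDefect_nonpos (x y : V) : normDefect x y ≤ 0 := by
  have := norm_sub_le x y
  unfold normDefect
  linarith

theorem normDefect_comm (x y : V) : normDefect x y = normDefect y x := by
  rw [normDefect, normDefect, norm_sub_rev]
  ring

theorem abs_normDefect_le_right (x y : V) : |normDefect x y| ≤ 2 * ‖y‖ := by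
  rw [abs_of_nonpos (normDefect_nonpos x y)]
  have := norm_sub_norm_le x y
  unfold normDefect
  linarith

theorem abs_normDefect_le_left (x y : V) : |normDefect x y| ≤ 2 * ‖x‖ :=
  normDefect_comm x y ▸ abs_normDefect_le_right y x

theorem normDefect_smul [NormedSpace ℝ V] {a : ℝ} (ha : 0 ≤ a) (x y : V) :
    normDefect (a • x) (a • y) = a * normDefect x y := by
  simp only [normDefect, ← smul_sub, norm_smul, Real.norm_of_nonneg ha]
  ring

/-- The signed defect, penalized by a multiple of the norms. -/
def penalizedDefect (η : ℝ) (e : Bool) (x y : V) : ℝ :=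
  boolSign e * normDefect x y - η * ‖x‖ - η * ‖y‖

theorem penalizedDefect_smul [NormedSpace ℝ V] {a : ℝ} (ha : 0 ≤ a) (η : ℝ) (e : Bool) (x y : V) :
    penalizedDefect η e (a • x) (a • y) = a * penalizedDefect η e x y := by
  simp only [penalizedDefect, normDefect_smul ha, norm_smul, Real.norm_of_nonneg ha]
  ring

theorem penalizedDefect_nonpos_of_le_right {η : ℝ} (hη : 0 ≤ η) {x y : V} (h : 2 * ‖y‖ ≤ η * ‖x‖)
    (e : Bool) : penalizedDefect η e x y ≤ 0 := by
  have := mul_nonneg hη (norm_nonneg y)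
  unfold penalizedDefect
  linarith [boolSign_mul_le_abs e (normDefect x y), abs_normDefect_le_right x y]

theorem penalizedDefect_nonpos_of_le_left {η : ℝ} (hη : 0 ≤ η) {x y : V} (h : 2 * ‖x‖ ≤ η * ‖y‖)
    (e : Bool) : penalizedDefect η e x y ≤ 0 := by
  have := mul_nonneg hη (norm_nonneg x)
  unfold penalizedDefect
  linarith [boolSign_mul_le_abs e (normDefect x y), abs_normDefect_le_left x y]

/-- The penalized signed defects along the paths of trees of depth `n` have nonpositive mean, for
every labelling of the nodes and leaves by elements of `V`. -/
def DefectBound (V : Type*) [SeminormedAddCommGroup V] (η : ℝ) (n : ℕ) : Prop :=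
  ∀ b x : List Bool → V,
    𝔼 s : Fin n → Bool,
      pathSum (fun e => penalizedDefect η e (x (List.ofFn s))) b (List.ofFn s) ≤ 0

/-- The points of norm between `1` and `2`. -/
def unitShell (V : Type*) [SeminormedAddCommGroup V] : Set V := {x | 1 ≤ ‖x‖ ∧ ‖x‖ ≤ 2}

/-- The constant in `meanExcess_unitShell_le`. -/
noncomputable def shellConst (η : ℝ) (r N : ℕ) : ℝ :=
  Real.exp (-(η / 4 ^ 2 * (η * N))) / (η / 4 ^ 2) * (1 + 2 * Real.exp (η / 4) * N) ^ r

theorem tendsto_shellConst {η : ℝ} (hη : 0 < η) (r : ℕ) :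
    Tendsto (shellConst η r) atTop (𝓝 0) := by
  set κ := 2 * Real.exp (η / 4) with hκ
  have hκ0 : 0 < κ := by positivity
  set t := η / 4 ^ 2 with ht
  have ht0 : 0 < t := by positivity
  have hu : Tendsto (fun N : ℕ => t * η / κ * (1 + κ * N)) atTop atTop :=
    (tendsto_atTop_add_const_left _ _
      (tendsto_natCast_atTop_atTop.const_mul_atTop hκ0)).const_mul_atTop (by positivity)
  have hlim := ((Real.tendsto_pow_mul_exp_neg_atTop_nhds_zero r).comp hu).const_mul
    (Real.exp (t * η / κ) / t * (κ / (t * η)) ^ r)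
  rw [mul_zero] at hlim
  refine hlim.congr fun N => ?_
  have hexp : Real.exp (-(t * (η * N))) =
      Real.exp (t * η / κ) * Real.exp (-(t * η / κ * (1 + κ * N))) := by
    rw [← Real.exp_add]
    congr 1
    field_simp
    ring
  rw [shellConst, ← hκ, ← ht, hexp, Function.comp_apply, mul_pow, div_pow, div_pow]
  field_simp

theorem meanExcess_unitShell_le {η : ℝ} (hη : 0 < η) {r : ℕ}
    (hr : ¬ Shatters (sublevel normDefect) (superlevel normDefect (η / 2)) r (unitShell V)
      (Prod.fst ⁻¹' {y | ‖y‖ ≤ 4 / η}))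
    (N : ℕ) (b x : List Bool → V) :
    meanExcess (penalizedDefect η) (unitShell V) (η * N) N b x ≤
      shellConst η r N *
        𝔼 s : Fin N → Bool, pathSum (fun _ => {y | η / 2 < ‖y‖}.indicator 1) b (List.ofFn s) := by
  refine meanExcess_le_mul_expect (by positivity) (by unfold shellConst; positivity)
    (fun e x hx y hy => ?_) (fun n hn b x => ?_) le_rfl
  · refine penalizedDefect_nonpos_of_le_right hη.le ?_ e
    have : η * 1 ≤ η * ‖x‖ := by gcongr; exact hx.1
    have : ‖y‖ ≤ η / 2 := not_lt.1 hy
    linarith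
  · have hmoment := expMoment_le (c := penalizedDefect η) (n := n) (b := b) (x := x)
      (show (0 : ℝ) < 4 by norm_num) hη
      (fun x hx y _ => by linarith [abs_normDefect_le_left x y, hx.2])
      (fun e x hx y _ => by
        have : η * 1 ≤ η * ‖x‖ := by gcongr; exact hx.1
        have : 0 ≤ η * ‖y‖ := by positivity
        unfold penalizedDefect
        linarith)
      (fun e x hx y hy => by
        refine penalizedDefect_nonpos_of_le_left hη.le ?_ e
        have := (div_lt_iff₀' hη).1 (not_le.1 hy)
        linarith [hx.2]) hr
    refine (meanExcess_le_expMoment (show 0 < η / 4 ^ 2 by positivity)).trans ?_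
    unfold shellConst
    gcongr
    exact hmoment.trans (by gcongr)

end Defect

section Scales

theorem sum_two_zpow_le {s : Finset ℤ} {m : ℤ} (h : ∀ k ∈ s, k ≤ m) :
    ∑ k ∈ s, (2 : ℝ) ^ k ≤ 2 * 2 ^ m := by
  induction s using Finset.induction_on_max generalizing m with
  | empty =>
    simp only [Finset.sum_empty]
    positivity
  | insert a s ha ih =>
    rw [Finset.sum_insert (fun h => lt_irrefl _ (ha a h))]
    calc (2 : ℝ) ^ a + ∑ k ∈ s, (2 : ℝ) ^ k ≤ 2 ^ a + 2 * 2 ^ (a - 1) := by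
          gcongr
          exact ih fun k hk => Int.le_sub_one_of_lt (ha k hk)
      _ = 2 * 2 ^ a := by rw [zpow_sub_one₀ two_ne_zero]; ring
      _ ≤ 2 * 2 ^ m := by
          gcongr
          exacts [one_le_two, h a (Finset.mem_insert_self _ _)]

theorem sum_two_zpow_mul_indicator_le (s : Finset ℤ) {t : ℝ} (ht : 0 ≤ t) :
    ∑ k ∈ s, (2 : ℝ) ^ k * (Set.Ioi ((2 : ℝ) ^ k)).indicator 1 t ≤ 2 * t := by
  simp only [Set.indicator_apply, Set.mem_Ioi, Pi.one_apply, mul_ite, mul_one, mul_zero]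
  rw [← Finset.sum_filter]
  rcases ht.eq_or_lt with rfl | ht
  · rw [mul_zero]
    refine (Finset.sum_eq_zero fun k hk => ?_).le
    exact absurd (Finset.mem_filter.1 hk).2 (show (0 : ℝ) < 2 ^ k by positivity).not_gt
  · refine (sum_two_zpow_le (m := Int.log 2 t) fun k hk => ?_).trans ?_
    · exact (Int.zpow_le_iff_le_log one_lt_two ht).1 (by simpa using (Finset.mem_filter.1 hk).2.le)
    · gcongr
      simpa using Int.zpow_log_le_self one_lt_two ht

variable {V : Type*} [SeminormedAddCommGroup V]

theorem pathSum_penalizedDefect_two_mul (η : ℝ) (b : List Bool → V) (x : V) (l : List Bool) :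
    pathSum (fun e => penalizedDefect (2 * η) e x) b l =
      pathSum (fun e => penalizedDefect η e x) b l - η * l.length * ‖x‖ +
        pathSum (fun _ y => -η * ‖y‖) b l := by
  have h : (fun e => penalizedDefect (2 * η) e x) =
      fun e y => (penalizedDefect η e x y + -η * ‖x‖) + -η * ‖y‖ := by
    funext e y
    unfold penalizedDefect
    ring
  rw [h, pathSum_add, pathSum_add, pathSum_const, nsmul_eq_mul]
  ring

variable [NormedSpace ℝ V]

theorem inv_smul_mem_unitShell_iff {σ : ℝ} (hσ : 0 < σ) {z : V} :
    σ⁻¹ • z ∈ unitShell V ↔ σ ≤ ‖z‖ ∧ ‖z‖ ≤ σ * 2 := by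
  rw [unitShell, Set.mem_ofPred_eq, norm_smul, Real.norm_of_nonneg (inv_pos.2 hσ).le,
    le_inv_mul_iff₀ hσ, inv_mul_le_iff₀ hσ, mul_one]

theorem meanExcess_penalizedDefect_smul {σ : ℝ} (hσ : 0 < σ) (η a : ℝ) (G : Set V) (n : ℕ)
    (b x : List Bool → V) :
    meanExcess (penalizedDefect η) ((σ⁻¹ • ·) ⁻¹' G) (σ * a) n b x =
      σ * meanExcess (penalizedDefect η) G a n (fun l => σ⁻¹ • b l) (fun l => σ⁻¹ • x l) := by
  rw [meanExcess, meanExcess, Finset.mul_expect]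
  refine Finset.expect_congr rfl fun s _ => ?_
  rw [pathSum_comp _ (σ⁻¹ • ·), mul_left_comm, mul_max_of_nonneg _ _ hσ.le, mul_zero, mul_sub,
    mul_pathSum]
  simp only [← penalizedDefect_smul hσ.le, smul_inv_smul₀ hσ.ne']
  rfl

theorem meanExcess_shell_le {η : ℝ} (hη : 0 < η) {r : ℕ}
    (hr : ¬ Shatters (sublevel normDefect) (superlevel normDefect (η / 2)) r (unitShell V)
      (Prod.fst ⁻¹' {y | ‖y‖ ≤ 4 / η}))
    {σ : ℝ} (hσ : 0 < σ) (N : ℕ) (b x : List Bool → V) :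
    meanExcess (penalizedDefect η) ((σ⁻¹ • ·) ⁻¹' unitShell V) (σ * (η * N)) N b x ≤
      shellConst η r N * 𝔼 s : Fin N → Bool,
        pathSum (fun _ y => σ * (Set.Ioi σ).indicator 1 (2 / η * ‖y‖)) b (List.ofFn s) := by
  rw [meanExcess_penalizedDefect_smul hσ]
  refine (mul_le_mul_of_nonneg_left
    (meanExcess_unitShell_le hη hr N _ _) hσ.le).trans_eq ?_
  rw [mul_left_comm, Finset.mul_expect]
  congr 2 with s
  rw [mul_pathSum, pathSum_comp _ (σ⁻¹ • ·)]
  congr 1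
  funext _ y
  have : η / 2 < ‖σ⁻¹ • y‖ ↔ σ < 2 / η * ‖y‖ := by
    rw [norm_smul, Real.norm_of_nonneg (inv_pos.2 hσ).le, lt_inv_mul_iff₀ hσ, div_mul_eq_mul_div,
      lt_div_iff₀ hη, ← mul_div_assoc, div_lt_iff₀' two_pos]
  simp only [Set.indicator_apply, Set.mem_ofPred_eq, Set.mem_Ioi, this, Pi.one_apply]

theorem pathSum_sub_le_sum_excess {η a : ℝ} (hη : 0 ≤ η) (ha : 0 ≤ a) {S : Finset ℤ}
    (b : List Bool → V) {x : V} (hx : Int.log 2 ‖x‖ ∈ S) (l : List Bool) :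
    pathSum (fun e => penalizedDefect η e x) b l - a * ‖x‖ ≤
      ∑ k ∈ S, ((((2 : ℝ) ^ k)⁻¹ • ·) ⁻¹' unitShell V).indicator 1 x *
        max 0 (pathSum (fun e => penalizedDefect η e x) b l - 2 ^ k * a) := by
  have hnonneg : ∀ k ∈ S, 0 ≤ ((((2 : ℝ) ^ k)⁻¹ • ·) ⁻¹' unitShell V).indicator (1 : V → ℝ) x *
      max 0 (pathSum (fun e => penalizedDefect η e x) b l - 2 ^ k * a) := fun k _ =>
    mul_nonneg (indicator_one_nonneg _ _) (le_max_left _ _)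
  rcases (norm_nonneg x).eq_or_lt' with h0 | hpos
  · refine le_trans ?_ (Finset.sum_nonneg hnonneg)
    have := pathSum_mono (fun e y => penalizedDefect_nonpos_of_le_left (x := x) (y := y) hη
      (by rw [h0, mul_zero]; positivity) e) b l
    simpa [h0, pathSum_const] using this
  · refine le_trans ?_ (Finset.single_le_sum hnonneg hx)
    have hlog : (2 : ℝ) ^ Int.log 2 ‖x‖ ≤ ‖x‖ := by
      simpa using Int.zpow_log_le_self one_lt_two hpos
    have hlog' : ‖x‖ < 2 ^ Int.log 2 ‖x‖ * 2 := by
      simpa [zpow_add_one₀] using Int.lt_zpow_succ_log_self one_lt_two ‖x‖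
    have hmem : x ∈ ((((2 : ℝ) ^ Int.log 2 ‖x‖)⁻¹ • ·) ⁻¹' unitShell V : Set V) :=
      (inv_smul_mem_unitShell_iff (by positivity)).2 ⟨hlog, hlog'.le⟩
    rw [Set.indicator_of_mem hmem, Pi.one_apply, one_mul, mul_comm a]
    exact le_max_of_le_right (by gcongr)

theorem expect_penalizedDefect_two_mul_le {η : ℝ} (hη : 0 ≤ η) {N : ℕ} (b x : List Bool → V)
    {S : Finset ℤ} (hS : ∀ s : Fin N → Bool, Int.log 2 ‖x (List.ofFn s)‖ ∈ S) :
    𝔼 s : Fin N → Bool,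
        pathSum (fun e => penalizedDefect (2 * η) e (x (List.ofFn s))) b (List.ofFn s) ≤
      ∑ k ∈ S, meanExcess (penalizedDefect η) ((((2 : ℝ) ^ k)⁻¹ • ·) ⁻¹' unitShell V)
          (2 ^ k * (η * N)) N b x +
        𝔼 s : Fin N → Bool, pathSum (fun _ y => -η * ‖y‖) b (List.ofFn s) := by
  simp only [meanExcess]
  rw [← Finset.expect_sum_comm, ← Finset.expect_add_distrib]
  refine Finset.expect_le_expect fun s _ => ?_
  rw [pathSum_penalizedDefect_two_mul, List.length_ofFn]
  gcongr
  exact pathSum_sub_le_sum_excess hη (by positivity) b (hS s) _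

theorem exists_defectBound_of_not_shatters {η : ℝ} (hη : 0 < η) {r : ℕ}
    (hr : ¬ Shatters (sublevel normDefect) (superlevel normDefect (η / 2)) r (unitShell V)
      (Prod.fst ⁻¹' {y | ‖y‖ ≤ 4 / η})) :
    ∃ N : ℕ, 0 < N ∧ DefectBound V (2 * η) N := by
  obtain ⟨N, hN, hN0⟩ := (((tendsto_shellConst hη r).eventually_lt_const
    (show 0 < η * η / 4 by positivity)).and (eventually_gt_atTop 0)).exists
  refine ⟨N, hN0, fun b x => ?_⟩
  set K := shellConst η r N
  let S : Finset ℤ := Finset.univ.image fun s : Fin N → Bool => Int.log 2 ‖x (List.ofFn s)‖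
  have hnode (y : V) :
      K * ∑ k ∈ S, 2 ^ k * (Set.Ioi ((2 : ℝ) ^ k)).indicator 1 (2 / η * ‖y‖) + -η * ‖y‖ ≤ 0 := by
    have hnonneg : 0 ≤ ∑ k ∈ S, (2 : ℝ) ^ k * (Set.Ioi ((2 : ℝ) ^ k)).indicator 1 (2 / η * ‖y‖) :=
      Finset.sum_nonneg fun k _ => mul_nonneg (by positivity) (indicator_one_nonneg _ _)
    have hsum := sum_two_zpow_mul_indicator_le S (t := 2 / η * ‖y‖) (by positivity)
    calc _ ≤ η * η / 4 * (2 * (2 / η * ‖y‖)) + -η * ‖y‖ := by gcongr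
      _ = 0 := by field_simp; ring
  calc _ ≤ _ := expect_penalizedDefect_two_mul_le hη.le b x (S := S) fun s =>
        Finset.mem_image_of_mem (fun s : Fin N → Bool => Int.log 2 ‖x (List.ofFn s)‖)
          (Finset.mem_univ s)
    _ ≤ ∑ k ∈ S, K * 𝔼 s : Fin N → Bool, pathSum (fun _ y =>
          2 ^ k * (Set.Ioi ((2 : ℝ) ^ k)).indicator 1 (2 / η * ‖y‖)) b (List.ofFn s) +
        𝔼 s : Fin N → Bool, pathSum (fun _ y => -η * ‖y‖) b (List.ofFn s) := by
        gcongr with k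
        exact meanExcess_shell_le hη hr (by positivity) N b x
    _ = 𝔼 s : Fin N → Bool, pathSum (fun _ y =>
          K * ∑ k ∈ S, 2 ^ k * (Set.Ioi ((2 : ℝ) ^ k)).indicator 1 (2 / η * ‖y‖) + -η * ‖y‖)
            b (List.ofFn s) := by
        simp only [pathSum_add, ← mul_pathSum K, pathSum_sum, Finset.expect_add_distrib,
          ← Finset.mul_expect, Finset.expect_sum_comm, Finset.mul_sum]
    _ ≤ 𝔼 s : Fin N → Bool, 0 := by
        refine Finset.expect_le_expect fun s _ => ?_
        simpa [pathSum_const] using pathSum_mono (fun _ => hnode) b (List.ofFn s)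
    _ = 0 := Finset.expect_const_zero _

end Scales

section Approximation

theorem tendsto_pathSum {ι B : Type*} {l : Filter ι} {c : ι → Bool → B → ℝ} {c' : Bool → B → ℝ}
    (hc : ∀ e y, Tendsto (fun k => c k e y) l (𝓝 (c' e y))) (b : List Bool → B) (s : List Bool) :
    Tendsto (fun k => pathSum (c k) b s) l (𝓝 (pathSum c' b s)) := by
  induction s generalizing b with
  | nil => exact tendsto_const_nhds
  | cons e s ih => exact (hc _ _).add (ih _)

variable {V W : Type*} [SeminormedAddCommGroup V] [SeminormedAddCommGroup W]

theorem DefectBound.of_tendsto_norm {ι : Type*} {l : Filter ι} [l.NeBot] {η : ℝ} {n : ℕ}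
    (hV : DefectBound V η n) (T : ι → W → V)
    (hT : ∀ w, Tendsto (fun k => ‖T k w‖) l (𝓝 ‖w‖))
    (hTsub : ∀ w w', Tendsto (fun k => ‖T k w - T k w'‖) l (𝓝 ‖w - w'‖)) :
    DefectBound W η n := by
  have hpen (e : Bool) (x y : W) :
      Tendsto (fun k => penalizedDefect η e (T k x) (T k y)) l (𝓝 (penalizedDefect η e x y)) :=
    (((((hTsub x y).sub (hT x)).sub (hT y)).const_mul _).sub ((hT x).const_mul _)).sub
      ((hT y).const_mul _)
  intro b x
  refine le_of_tendsto' (f := fun k => 𝔼 s : Fin n → Bool, pathSum (fun e y =>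
    penalizedDefect η e (T k (x (List.ofFn s))) (T k y)) b (List.ofFn s)) (x := l) ?_ fun k => ?_
  · simp only [Fintype.expect_eq_sum_div_card]
    exact (tendsto_finsetSum _ fun s _ =>
      tendsto_pathSum (fun e y => hpen e _ y) b _).div_const _
  · simp only [← pathSum_comp (fun e => penalizedDefect η e _) (T k)]
    exact hV (fun m => T k (b m)) fun m => T k (x m)

theorem DefectBound.completion {η : ℝ} {n : ℕ} (hV : DefectBound V η n) :
    DefectBound (UniformSpace.Completion V) η n := by
  let l : Filter (UniformSpace.Completion V → V) :=
    comap (Pi.map fun _ => ((↑) : V → UniformSpace.Completion V)) (𝓝 id)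
  have : l.NeBot := comap_neBot_iff.2 fun t ht =>
    DenseRange.mem_nhds (DenseRange.piMap fun _ => UniformSpace.Completion.denseRange_coe) ht
  have hl (w : UniformSpace.Completion V) : Tendsto (fun t => ((t w : V) :
      UniformSpace.Completion V)) l (𝓝 w) :=
    tendsto_pi_nhds.1 (tendsto_comap : Tendsto (Pi.map fun _ => _) l (𝓝 id)) w
  refine hV.of_tendsto_norm (l := l) id (fun w => ?_) fun w w' => ?_
  · simpa using (hl w).norm
  · simpa [← UniformSpace.Completion.coe_sub] using ((hl w).sub (hl w')).norm

end Approximation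

section FiniteRepresentability

variable {W Y : Type*} [NormedAddCommGroup W] [NormedSpace ℝ W] [NormedAddCommGroup Y]
  [NormedSpace ℝ Y]

theorem IsFinitelyRepresentable.exists_linearMap (h : IsFinitelyRepresentable W Y)
    (s : Finset W) {ε : ℝ} (hε : 0 < ε) :
    ∃ S : W →ₗ[ℝ] Y, ∀ w ∈ Submodule.span ℝ (s : Set W),
      ‖w‖ ≤ ‖S w‖ ∧ ‖S w‖ ≤ (1 + ε) * ‖w‖ := by
  obtain ⟨F, T, hT⟩ := h (Submodule.span ℝ s) (FiniteDimensional.span_finset ℝ s) ε hε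
  set c := ‖(T.symm : F →L[ℝ] Submodule.span ℝ (s : Set W))‖
  have hc : 0 ≤ c := norm_nonneg (T.symm : F →L[ℝ] Submodule.span ℝ (s : Set W))
  obtain ⟨S, hS⟩ := LinearMap.exists_extend
    (c • F.subtype ∘ₗ (T : Submodule.span ℝ (s : Set W) →ₗ[ℝ] F))
  refine ⟨S, fun w hw => ?_⟩
  have hSw : ‖S w‖ = c * ‖T ⟨w, hw⟩‖ := by
    simpa [norm_smul, abs_of_nonneg hc] using congrArg norm (LinearMap.congr_fun hS ⟨w, hw⟩)
  rw [hSw]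
  constructor
  · simpa using (T.symm : F →L[ℝ] Submodule.span ℝ (s : Set W)).le_opNorm (T ⟨w, hw⟩)
  · calc c * ‖T ⟨w, hw⟩‖
        ≤ c * (‖(T : Submodule.span ℝ (s : Set W) →L[ℝ] F)‖ * ‖w‖) := by
          gcongr
          exact (T : Submodule.span ℝ (s : Set W) →L[ℝ] F).le_opNorm _
      _ = ‖(T : Submodule.span ℝ (s : Set W) →L[ℝ] F)‖ * c * ‖w‖ := by ring
      _ ≤ (1 + ε) * ‖w‖ := by gcongr

theorem IsFinitelyRepresentable.defectBound (h : IsFinitelyRepresentable W Y) {η : ℝ} {n : ℕ}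
    (hY : DefectBound Y η n) : DefectBound W η n := by
  classical
  choose S hS using fun p : Finset W × ℕ =>
    h.exists_linearMap p.1 (ε := 1 / ((p.2 : ℝ) + 1)) (by positivity)
  have hlim (w : W) (s : Finset W) (hw : w ∈ Submodule.span ℝ (s : Set W)) :
      Tendsto (fun p => ‖S p w‖) atTop (𝓝 ‖w‖) := by
    have hmem : ∀ᶠ p : Finset W × ℕ in atTop, w ∈ Submodule.span ℝ (p.1 : Set W) := by
      filter_upwards [eventually_ge_atTop (s, 0)] with p hp
      exact Submodule.span_mono (Finset.coe_subset.2 hp.1) hw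
    refine tendsto_of_tendsto_of_tendsto_of_le_of_le' tendsto_const_nhds
      (h := fun p : Finset W × ℕ => (1 + 1 / ((p.2 : ℝ) + 1)) * ‖w‖) ?_
      (hmem.mono fun p hp => (hS p w hp).1) (hmem.mono fun p hp => (hS p w hp).2)
    rw [← prod_atTop_atTop_eq]
    simpa only [add_zero, one_mul, Function.comp_def] using
      (((tendsto_one_div_add_atTop_nhds_zero_nat (𝕜 := ℝ)).const_add 1).mul_const ‖w‖).comp
        tendsto_snd
  refine hY.of_tendsto_norm (l := atTop) (fun p => S p) (fun w => ?_) fun w w' => ?_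
  · exact hlim w {w} (Submodule.subset_span (by simp))
  · simp only [← map_sub]
    exact hlim _ {w - w'} (Submodule.subset_span (by simp))

end FiniteRepresentability

section MeanSpace

variable {I : Type*} [TopologicalSpace I]

/-- The bounded continuous functions from `I` to `Y` with the seminorm `g ↦ m ‖g‖`, for a positive
functional `m`: a dense part of an `L¹` space, before the identification of functions at
distance zero. -/
def PreL1 (_ : (I →ᵇ ℝ) →ₚ[ℝ] ℝ) (Y : Type*) [SeminormedAddCommGroup Y] : Type _ := I →ᵇ Y

variable (m : (I →ᵇ ℝ) →ₚ[ℝ] ℝ) (Y : Type*) [SeminormedAddCommGroup Y]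

namespace PreL1

noncomputable instance : AddCommGroup (PreL1 m Y) := inferInstanceAs (AddCommGroup (I →ᵇ Y))

noncomputable instance [NormedSpace ℝ Y] : Module ℝ (PreL1 m Y) :=
  inferInstanceAs (Module ℝ (I →ᵇ Y))

variable {Y}

/-- A bounded continuous function as an element of `PreL1`. -/
noncomputable def of : (I →ᵇ Y) ≃+ PreL1 m Y := AddEquiv.refl _

variable {m}

theorem of_smul [NormedSpace ℝ Y] (c : ℝ) (g : I →ᵇ Y) : of m (c • g) = c • of m g := rfl

variable (m Y)

/-- The seminorm `g ↦ m ‖g‖`. -/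
noncomputable def addGroupSeminorm : AddGroupSeminorm (PreL1 m Y) where
  toFun g := m ((of m).symm g).normComp
  map_zero' := by
    convert map_zero m
    ext
    simp
  add_le' f g := by
    rw [← map_add]
    exact OrderHomClass.mono m fun i => by simpa using norm_add_le _ _
  neg' f := by
    congr 1
    ext
    simp

noncomputable instance : SeminormedAddCommGroup (PreL1 m Y) :=
  (addGroupSeminorm m Y).toSeminormedAddCommGroup

variable {m Y}

theorem norm_of (g : I →ᵇ Y) : ‖of m g‖ = m g.normComp := rfl

noncomputable instance [NormedSpace ℝ Y] : NormedSpace ℝ (PreL1 m Y) where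
  norm_smul_le c g := by
    obtain ⟨g, rfl⟩ := (of m).surjective g
    rw [← of_smul, norm_of, norm_of, ← smul_eq_mul, ← map_smul]
    refine (congrArg m ?_).le
    ext
    simp [norm_smul]

/-- The pointwise penalized defect. -/
noncomputable def penalizedDefectFun (η : ℝ) (e : Bool) (f g : I →ᵇ Y) : I →ᵇ ℝ :=
  boolSign e • ((f - g).normComp - f.normComp - g.normComp) - η • f.normComp - η • g.normComp

theorem penalizedDefectFun_apply (η : ℝ) (e : Bool) (f g : I →ᵇ Y) (i : I) :
    penalizedDefectFun η e f g i = penalizedDefect η e (f i) (g i) := by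
  simp [penalizedDefectFun, penalizedDefect, normDefect]

theorem map_penalizedDefectFun (η : ℝ) (e : Bool) (f g : I →ᵇ Y) :
    m (penalizedDefectFun η e f g) = penalizedDefect η e (of m f) (of m g) := by
  simp only [penalizedDefectFun, penalizedDefect, normDefect, map_sub, map_smul, smul_eq_mul,
    ← norm_of]

theorem defectBound {η : ℝ} {n : ℕ} (hY : DefectBound Y η n) : DefectBound (PreL1 m Y) η n := by
  intro b x
  obtain ⟨b, rfl⟩ : ∃ b' : List Bool → I →ᵇ Y, (fun l => of m (b' l)) = b :=
    ⟨fun l => (of m).symm (b l), by simp⟩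
  obtain ⟨x, rfl⟩ : ∃ x' : List Bool → I →ᵇ Y, (fun l => of m (x' l)) = x :=
    ⟨fun l => (of m).symm (x l), by simp⟩
  set D : I →ᵇ ℝ := ∑ s : Fin n → Bool,
    pathSum (fun e => penalizedDefectFun η e (x (List.ofFn s))) b (List.ofFn s)
  have hD : D ≤ 0 := fun i => by
    have := hY (fun l => b l i) fun l => x l i
    rw [Fintype.expect_eq_sum_div_card, div_le_iff₀ (by positivity), zero_mul] at this
    refine le_of_eq_of_le ?_ this
    change BoundedContinuousFunction.evalCLM ℝ i D = _
    simp only [D, map_sum, map_pathSum, pathSum_comp _ fun g : I →ᵇ Y => g i]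
    simp only [BoundedContinuousFunction.evalCLM_apply, penalizedDefectFun_apply]
  have hmD : ∑ s : Fin n → Bool, pathSum (fun e => penalizedDefect η e (of m (x (List.ofFn s))))
      (fun l => of m (b l)) (List.ofFn s) = m D := by
    simp only [D, map_sum, map_pathSum, map_penalizedDefectFun, pathSum_comp _ (of m)]
  rw [Fintype.expect_eq_sum_div_card, hmD]
  exact div_nonpos_of_nonpos_of_nonneg (by simpa using OrderHomClass.mono m hD) (by positivity)

end PreL1
end MeanSpace

section Ultralimit

theorem exists_tendsto_of_forall_abs_le {J : Type*} (U : Ultrafilter J) {f : J → ℝ} {C : ℝ}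
    (hf : ∀ j, |f j| ≤ C) : ∃ a, Tendsto f U (𝓝 a) := by
  obtain ⟨a, -, ha⟩ := (isCompact_Icc (a := -C) (b := C)).ultrafilter_le_nhds' (U.map f)
    (Ultrafilter.mem_map.2 (univ_mem' fun j => abs_le.1 (hf j)))
  exact ⟨a, ha⟩

variable {I : Type*} [TopologicalSpace I]

theorem le_map_of_forall_le {m : (I →ᵇ ℝ) →ₚ[ℝ] ℝ} (hm : m 1 = 1) {f : I →ᵇ ℝ} {c : ℝ}
    (hc : ∀ i, c ≤ f i) : c ≤ m f := by
  have := OrderHomClass.mono m (show c • (1 : I →ᵇ ℝ) ≤ f from fun i => by simpa using hc i)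
  rwa [map_smul, hm, smul_eq_mul, mul_one] at this

theorem abs_map_le_norm {m : (I →ᵇ ℝ) →ₚ[ℝ] ℝ} (hm : m 1 = 1) (f : I →ᵇ ℝ) : |m f| ≤ ‖f‖ := by
  refine abs_le.2 ⟨le_map_of_forall_le hm f.neg_norm_le_apply, ?_⟩
  have := le_map_of_forall_le hm (f := -f) fun i => neg_le_neg (f.apply_le_norm i)
  rwa [map_neg, neg_le_neg_iff] at this

theorem exists_ultralimit {J : Type*} (U : Ultrafilter J) (A : J → (I →ᵇ ℝ) →ₚ[ℝ] ℝ)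
    (hA : ∀ j, A j 1 = 1) :
    ∃ m : (I →ᵇ ℝ) →ₚ[ℝ] ℝ, m 1 = 1 ∧ ∀ f, Tendsto (fun j => A j f) U (𝓝 (m f)) := by
  choose m hm using fun f : I →ᵇ ℝ =>
    exists_tendsto_of_forall_abs_le U fun j => abs_map_le_norm (hA j) f
  let L : (I →ᵇ ℝ) →ₗ[ℝ] ℝ :=
    { toFun := m
      map_add' := fun f g => tendsto_nhds_unique (hm _)
        (((hm f).add (hm g)).congr fun j => (map_add (A j) f g).symm)
      map_smul' := fun c f => tendsto_nhds_unique (hm _)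
        (((hm f).const_mul c).congr fun j => (map_smul (A j) c f).symm) }
  refine ⟨.mk₀ L fun f hf => ge_of_tendsto' (hm f) fun j => map_nonneg (A j) hf, ?_, hm⟩
  exact tendsto_nhds_unique (hm 1) (tendsto_const_nhds.congr fun j => (hA j).symm)

theorem exists_ultrafilter_limit (U : Ultrafilter I) :
    ∃ m : (I →ᵇ ℝ) →ₚ[ℝ] ℝ, ∀ f : I →ᵇ ℝ, Tendsto f U (𝓝 (m f)) := by
  let A (i : I) : (I →ᵇ ℝ) →ₚ[ℝ] ℝ :=
    .mk₀ (BoundedContinuousFunction.evalCLM (β := ℝ) ℝ i).toLinearMap fun f hf => hf i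
  obtain ⟨m, -, hm⟩ := exists_ultralimit U A fun _ => rfl
  exact ⟨m, hm⟩

end Ultralimit

section AlmostIsometry

variable {E V W Y : Type*} [NormedAddCommGroup Y] [NormedSpace ℝ Y]

theorem isFinitelyRepresentable_of_exists_linearMap [NormedAddCommGroup W] [NormedSpace ℝ W]
    (h : ∀ E : Submodule ℝ W, FiniteDimensional ℝ E → ∀ θ : ℝ, 0 < θ →
      ∃ T : E →ₗ[ℝ] Y, ∀ x, |‖T x‖ - ‖x‖| ≤ θ * ‖x‖) :
    IsFinitelyRepresentable W Y := by
  intro E hE ε hε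
  set θ := min (1 / 2) (ε / 8)
  have hθ : 0 < θ := by positivity
  have hθ1 : θ ≤ 1 / 2 := min_le_left _ _
  have hθ2 : θ ≤ ε / 8 := min_le_right _ _
  obtain ⟨T, hT⟩ := h E hE θ hθ
  have hinj : Function.Injective T := by
    refine (injective_iff_map_eq_zero T).2 fun x hx => norm_eq_zero.1 ?_
    have := (abs_le.1 (hT x)).1
    rw [hx, norm_zero] at this
    nlinarith [norm_nonneg x]
  set S := (LinearEquiv.ofInjective T hinj).toContinuousLinearEquiv
  have hST (x : E) : ‖S x‖ = ‖T x‖ := rfl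
  refine ⟨LinearMap.range T, S, ?_⟩
  have hS : ‖(S : E →L[ℝ] LinearMap.range T)‖ ≤ 1 + θ :=
    ContinuousLinearMap.opNorm_le_bound _ (by positivity) fun x => by
      change ‖S x‖ ≤ _
      rw [hST]
      linarith [(abs_le.1 (hT x)).2]
  have hSsymm : ‖(S.symm : LinearMap.range T →L[ℝ] E)‖ ≤ (1 - θ)⁻¹ :=
    ContinuousLinearMap.opNorm_le_bound _ (inv_nonneg.2 (by linarith)) fun y => by
      change ‖S.symm y‖ ≤ _
      have := (abs_le.1 (hT (S.symm y))).1
      rw [← hST, ContinuousLinearEquiv.apply_symm_apply] at this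
      rw [inv_mul_eq_div, le_div_iff₀ (by linarith)]
      linarith
  calc _ ≤ (1 + θ) * (1 - θ)⁻¹ := by gcongr
    _ < 1 + ε := by
        rw [← div_eq_mul_inv, div_lt_iff₀ (by linarith)]
        nlinarith

variable [NormedAddCommGroup E] [NormedSpace ℝ E] [FiniteDimensional ℝ E]
  [SeminormedAddCommGroup V] [NormedSpace ℝ V]

theorem eventually_abs_norm_sub_le {ι : Type*} {l : Filter ι} {K : NNReal} (T : ι → E →ₗ[ℝ] Y)
    (hT : ∀ k, LipschitzWith K (T k)) (S : E →ₗ[ℝ] V)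
    (hlim : ∀ x, Tendsto (fun k => ‖T k x‖) l (𝓝 ‖S x‖)) {ε : ℝ} (hε : 0 < ε) :
    ∀ᶠ k in l, ∀ x, |‖T k x‖ - ‖S x‖| ≤ ε * ‖x‖ := by
  let F : ι → Metric.sphere (0 : E) 1 → ℝ := fun k x => ‖T k x‖
  have hF : Equicontinuous F := (LipschitzWith.uniformEquicontinuous F _ fun k =>
    lipschitzWith_one_norm.comp ((hT k).comp (LipschitzWith.subtype_val _))).equicontinuous
  have hunif := UniformFun.tendsto_iff_tendstoUniformly.1 ((hF.tendsto_uniformFun_iff_pi l _).2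
    (tendsto_pi_nhds.2 fun x => hlim x))
  filter_upwards [Metric.tendstoUniformly_iff.1 hunif ε hε] with k hk x
  rcases eq_or_ne x 0 with rfl | hx
  · simp
  · have hx' : 0 < ‖x‖ := norm_pos_iff.2 hx
    have hunit : dist ‖S (‖x‖⁻¹ • x)‖ ‖T k (‖x‖⁻¹ • x)‖ < ε :=
      hk ⟨‖x‖⁻¹ • x, by simp [norm_smul, hx'.ne']⟩
    rw [Real.dist_eq, abs_sub_comm] at hunit
    simp only [map_smul, norm_smul, norm_inv, norm_norm, ← mul_sub, abs_mul, abs_inv, abs_norm,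
      inv_mul_lt_iff₀ hx'] at hunit
    exact hunit.le.trans_eq (mul_comm _ _)

theorem exists_linearMap_norm_coe_sub_le (E : Submodule ℝ (UniformSpace.Completion V))
    [FiniteDimensional ℝ E] {ε : ℝ} (hε : 0 < ε) :
    ∃ L : E →ₗ[ℝ] V, ∀ x : E, ‖(L x : UniformSpace.Completion V) - x‖ ≤ ε * ‖x‖ := by
  let e := Module.finBasis ℝ E
  obtain ⟨C, hC, hbound⟩ := e.exists_opNorm_le (F := UniformSpace.Completion V)
  have happrox (i) : ∃ z : V, ‖(z : UniformSpace.Completion V) - e i‖ ≤ ε / C := by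
    obtain ⟨z, hz⟩ := UniformSpace.Completion.denseRange_coe.exists_dist_lt
      (e i : UniformSpace.Completion V) (div_pos hε hC)
    exact ⟨z, by rw [← dist_eq_norm, dist_comm]; exact hz.le⟩
  choose z hz using happrox
  let L : E →ₗ[ℝ] V := e.constr ℝ z
  let D : E →L[ℝ] UniformSpace.Completion V := LinearMap.toContinuousLinearMap
    ((UniformSpace.Completion.toComplₗᵢ (𝕜 := ℝ) (E := V)).toLinearMap ∘ₗ L - E.subtype)
  have hD : ‖D‖ ≤ C * (ε / C) := hbound (by positivity) fun i => by
    simpa [D, L, Module.Basis.constr_basis] using hz i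
  refine ⟨L, fun x => ?_⟩
  rw [mul_div_cancel₀ _ hC.ne'] at hD
  exact D.le_of_opNorm_le hD x

end AlmostIsometry

section Ultrapower

variable {I : Type u} [TopologicalSpace I] {m : (I →ᵇ ℝ) →ₚ[ℝ] ℝ}

theorem PreL1.isFinitelyRepresentable_completion {Y : Type v} [NormedAddCommGroup Y]
    [NormedSpace ℝ Y] {U : Ultrafilter I} (hm : ∀ f : I →ᵇ ℝ, Tendsto f U (𝓝 (m f))) :
    IsFinitelyRepresentable (UniformSpace.Completion (PreL1 m Y)) Y := by
  refine isFinitelyRepresentable_of_exists_linearMap fun E _ θ hθ => ?_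
  obtain ⟨L, hL⟩ := exists_linearMap_norm_coe_sub_le E (half_pos hθ)
  let L' : E →L[ℝ] (I →ᵇ Y) := LinearMap.toContinuousLinearMap
    { toFun := fun x => (of m).symm (L x)
      map_add' := fun x y => by simp
      map_smul' := fun c x => congrArg (of m).symm (map_smul L c x) }
  let T (i : I) : E →L[ℝ] Y := (BoundedContinuousFunction.evalCLM ℝ i).comp L'
  have hT (i : I) : LipschitzWith ‖L'‖₊ (T i) :=
    AddMonoidHomClass.lipschitz_of_bound_nnnorm (T i) _ fun x =>
      (BoundedContinuousFunction.norm_coe_le_norm (L' x) i).trans (L'.le_opNorm x)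
  obtain ⟨i, hi⟩ := (eventually_abs_norm_sub_le (l := U) (fun i => (T i : E →ₗ[ℝ] Y)) hT L
    (fun x => hm (L' x).normComp) (half_pos hθ)).exists
  refine ⟨T i, fun x => ?_⟩
  have hLx : |‖L x‖ - ‖x‖| ≤ θ / 2 * ‖x‖ := by
    simpa using (abs_norm_sub_norm_le (L x : UniformSpace.Completion (PreL1 m Y)) x).trans (hL x)
  calc _ ≤ _ := abs_sub_le _ ‖L x‖ _
    _ ≤ θ / 2 * ‖x‖ + θ / 2 * ‖x‖ := add_le_add (hi x) hLx
    _ = θ * ‖x‖ := by ring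

end Ultrapower

section NoJump

theorem IsStableSpace.exists_abs_sub_lt {M : Type*} [MetricSpace M] (hM : IsStableSpace M)
    {x y : ℕ → M} (hx : Bornology.IsBounded (Set.range x))
    (hy : Bornology.IsBounded (Set.range y)) {u : ℕ → ℝ} {R δ : ℝ} (hu : ∀ i, |u i| ≤ R)
    (hδ : 0 < δ) :
    ∃ j, ∃ i ≤ j, ∃ k > j, |(dist (x i) (y j) - u i) - (dist (x k) (y j) - u k)| < δ := by
  by_contra! hjump
  set U := hyperfilter ℕ
  have hU (n : ℕ) : U ≠ pure n := fun hn => by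
    have hmem : ({n}ᶜ : Set ℕ) ∈ U := (Set.finite_singleton n).compl_mem_hyperfilter
    exact (hn ▸ hmem : ({n}ᶜ : Set ℕ) ∈ (pure n : Ultrafilter ℕ)) rfl
  obtain ⟨C, hC⟩ := (Metric.isBounded_iff).1 (hx.union hy)
  have hd (i j : ℕ) : |dist (x i) (y j)| ≤ C := by
    rw [abs_of_nonneg dist_nonneg]
    exact hC (Or.inl ⟨i, rfl⟩) (Or.inr ⟨j, rfl⟩)
  choose g hg using fun i => exists_tendsto_of_forall_abs_le U (hd i)
  choose h hh using fun j => exists_tendsto_of_forall_abs_le U (hd · j)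
  obtain ⟨a, ha⟩ := exists_tendsto_of_forall_abs_le U fun i => le_of_tendsto' (hg i).abs (hd i)
  obtain ⟨b, hb⟩ := exists_tendsto_of_forall_abs_le U fun j => le_of_tendsto' (hh j).abs (hd · j)
  obtain ⟨c, hc⟩ := exists_tendsto_of_forall_abs_le U hu
  have hlarge (n : ℕ) : ∀ᶠ k in (U : Filter ℕ), n < k :=
    (eventually_gt_atTop n).filter_mono Nat.hyperfilter_le_atTop
  have hk (i j : ℕ) (hij : i ≤ j) : δ ≤ |(dist (x i) (y j) - u i) - (h j - c)| :=
    ge_of_tendsto (((hh j).sub hc).const_sub _).abs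
      ((hlarge j).mono fun k hjk => hjump j i hij k hjk)
  have hj (i : ℕ) : δ ≤ |(g i - u i) - (b - c)| :=
    ge_of_tendsto (((hg i).sub_const _).sub (hb.sub_const c)).abs
      ((hlarge i).mono fun j hij => hk i j hij.le)
  have hi : δ ≤ |(a - c) - (b - c)| := ge_of_tendsto' ((ha.sub hc).sub_const _).abs hj
  rw [hM x y hx hy U U hU hU g h a b hg ha hh hb, sub_self, abs_zero] at hi
  exact hδ.not_ge hi

theorem IsStableSpace.exists_abs_normDefect_sub_lt {W : Type*} [NormedAddCommGroup W]
    (hW : IsStableSpace W) {x y : ℕ → W} {R δ : ℝ} (hx : ∀ i, ‖x i‖ ≤ R) (hy : ∀ i, ‖y i‖ ≤ R)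
    (hδ : 0 < δ) :
    ∃ j, ∃ i ≤ j, ∃ k > j, |normDefect (x i) (y j) - normDefect (x k) (y j)| < δ := by
  have hbounded {z : ℕ → W} (hz : ∀ i, ‖z i‖ ≤ R) : Bornology.IsBounded (Set.range z) :=
    isBounded_iff_forall_norm_le.2 ⟨R, Set.forall_mem_range.2 hz⟩
  obtain ⟨j, i, hij, k, hjk, hlt⟩ := hW.exists_abs_sub_lt (hbounded hx) (hbounded hy)
    (u := fun i => ‖x i‖) (fun i => (abs_norm (x i)).trans_le (hx i)) hδ
  refine ⟨j, i, hij, k, hjk, ?_⟩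
  rwa [normDefect, normDefect, sub_sub_sub_cancel_right, ← dist_eq_norm, ← dist_eq_norm]

variable {Y : Type v} [NormedAddCommGroup Y] [NormedSpace ℝ Y]

namespace IsSuperstable

theorem exists_abs_normDefect_sub_lt (hY : IsSuperstable.{v, max u v} Y) (R : ℝ) {δ : ℝ}
    (hδ : 0 < δ) :
    ∃ n, ∀ x y : ℕ → Y, (∀ i, ‖x i‖ ≤ R) → (∀ j, ‖y j‖ ≤ R) →
      ∃ j < n, ∃ i ≤ j, ∃ k > j, |normDefect (x i) (y j) - normDefect (x k) (y j)| < δ := by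
  by_contra! hjump
  choose x y hx hy hjump using hjump
  obtain ⟨m, hm⟩ := exists_ultrafilter_limit ((hyperfilter ℕ).map ULift.up.{u})
  let seq (z : ℕ → ℕ → Y) (hz : ∀ n i, ‖z n i‖ ≤ R) (i : ℕ) : ULift.{u} ℕ →ᵇ Y :=
    .ofNormedAddCommGroupDiscrete (fun n => z n.down i) R fun n => hz n.down i
  have hnorm (g : ULift.{u} ℕ →ᵇ Y) :
      Tendsto (fun n => ‖g (.up n)‖) (hyperfilter ℕ) (𝓝 ‖PreL1.of m g‖) := hm g.normComp
  have hseq (z hz i) : ‖PreL1.of m (seq z hz i)‖ ≤ R :=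
    le_of_tendsto' (hnorm (seq z hz i)) fun n => hz n i
  have hst : IsStableSpace (UniformSpace.Completion (PreL1 m Y)) :=
    hY _ (PreL1.isFinitelyRepresentable_completion hm)
  obtain ⟨j, i, hij, k, hjk, hlt⟩ := hst.exists_abs_normDefect_sub_lt
    (x := fun i => (PreL1.of m (seq x hx i) : UniformSpace.Completion (PreL1 m Y)))
    (y := fun j => (PreL1.of m (seq y hy j) : UniformSpace.Completion (PreL1 m Y)))
    (fun i => by simpa using hseq x hx i) (fun j => by simpa using hseq y hy j) hδ
  have hdefect (i : ℕ) : Tendsto (fun n => normDefect (x n i) (y n j)) (hyperfilter ℕ)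
      (𝓝 (normDefect (PreL1.of m (seq x hx i) : UniformSpace.Completion (PreL1 m Y))
        (PreL1.of m (seq y hy j)))) := by
    simp only [normDefect, ← UniformSpace.Completion.coe_sub, UniformSpace.Completion.norm_coe]
    exact ((hnorm (seq x hx i - seq y hy j)).sub (hnorm _)).sub (hnorm _)
  refine hlt.not_ge (ge_of_tendsto ((hdefect i).sub (hdefect k)).abs ?_)
  filter_upwards [(eventually_gt_atTop j).filter_mono Nat.hyperfilter_le_atTop] with n hn
  exact hjump n j hn i hij k hjk

theorem exists_not_shatters (hY : IsSuperstable.{v, max u v} Y) (M : ℝ) {δ : ℝ} (hδ : 0 < δ) :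
    ∃ r, ¬ Shatters (sublevel normDefect) (superlevel normDefect δ) r (unitShell Y)
      (Prod.fst ⁻¹' {y | ‖y‖ ≤ M}) := by
  obtain ⟨n, hn⟩ := IsSuperstable.exists_abs_normDefect_sub_lt.{u} hY (max 2 M) (half_pos hδ)
  obtain ⟨r, hr⟩ := exists_hasLadder_of_shatters (A := Y) (sublevel normDefect)
    (superlevel normDefect δ) (superlevel normDefect (δ / 2)) (n + 1) (n + 1)
  have hladder {S T : Y × ℝ → Set Y} (hST : ∀ p x z, x ∈ S p → z ∈ T p →
      δ / 2 ≤ |normDefect x p.1 - normDefect z p.1|) :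
      ¬ HasLadder S T (n + 1) (unitShell Y) (Prod.fst ⁻¹' {y | ‖y‖ ≤ M}) := fun h => by
    obtain ⟨x, p, hx, hp, hrel⟩ := h.exists_seq
    obtain ⟨j, hj, i, hij, k, hjk, hlt⟩ := hn x (fun j => (p j).1)
      (fun i => (hx i).2.trans (le_max_left _ _)) (fun j => (hp j).trans (le_max_right _ _))
    exact hlt.not_ge (hST _ _ _ ((hrel j hj).1 i hij) ((hrel j hj).2 k hjk))
  refine ⟨r, fun h => (hr _ _ h).elim (hladder fun p x z hx hz => ?_)
    (hladder fun p x z hx hz => ?_)⟩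
  · refine le_abs.2 (Or.inl ?_)
    simp only [sublevel, superlevel, Set.mem_ofPred_eq] at hx hz
    linarith
  · refine le_abs.2 (Or.inr ?_)
    simp only [superlevel, Set.mem_compl_iff, Set.mem_ofPred_eq, not_le] at hx hz
    linarith

theorem exists_defectBound (hY : IsSuperstable.{v, max u v} Y) {η : ℝ} (hη : 0 < η) :
    ∃ N, 0 < N ∧ DefectBound Y η N := by
  obtain ⟨r, hr⟩ := IsSuperstable.exists_not_shatters.{u} hY (4 / (η / 2))
    (half_pos (half_pos hη))
  simpa only [mul_div_cancel₀ η two_ne_zero] using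
    exists_defectBound_of_not_shatters (half_pos hη) hr

end IsSuperstable
end NoJump

section Stability

variable {V W : Type*} [SeminormedAddCommGroup V] [NormedAddCommGroup W]

theorem DefectBound.not_shatters {η R α β : ℝ} {n : ℕ} (h : DefectBound V η n) (hη : 0 ≤ η)
    (hn : 0 < n) (hgap : 4 * R * η < β - α) :
    ¬ Shatters (fun y => {x | ‖x - y‖ - ‖x‖ ≤ α}) (fun y => {x | β ≤ ‖x - y‖ - ‖x‖}) n
      {x : V | ‖x‖ ≤ R} {y | ‖y‖ ≤ R} := by
  intro hs
  set γ := (β - α) / 2 - 2 * R * η with hγ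
  have hpenalty {x y : V} (hx : ‖x‖ ≤ R) (hy : ‖y‖ ≤ R) : η * ‖x‖ + η * ‖y‖ ≤ 2 * R * η := by
    nlinarith
  obtain ⟨b, x, hbx⟩ := hs.exists_tree (c := penalizedDefect η)
    (d := fun e y => boolSign e * ((α + β) / 2 - ‖y‖) + γ)
    (fun y hy x hx hlow => by
      simp only [penalizedDefect, boolSign_false, normDefect]
      linarith [hpenalty hx hy, Set.mem_ofPred_eq ▸ hlow])
    (fun y hy x hx hhigh => by
      simp only [penalizedDefect, boolSign_true, normDefect]
      linarith [hpenalty hx hy, Set.mem_ofPred_eq ▸ hhigh])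
  have hle : n * γ ≤ 0 := by
    calc n * γ = 𝔼 s : Fin n → Bool,
          pathSum (fun e y => boolSign e * ((α + β) / 2 - ‖y‖) + γ) b (List.ofFn s) := by
          simp [pathSum_add, pathSum_const, Finset.expect_add_distrib,
            expect_pathSum_boolSign_mul n (fun y : V => (α + β) / 2 - ‖y‖)]
      _ ≤ 𝔼 s : Fin n → Bool,
          pathSum (fun e => penalizedDefect η e (x (List.ofFn s))) b (List.ofFn s) :=
          Finset.expect_le_expect fun s _ => (hbx _ (List.length_ofFn)).2
      _ ≤ 0 := h b x
  have hγ0 : 0 < γ := by linarith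
  exact hle.not_gt (by positivity)

theorem le_of_iterated_limits_of_defectBound
    (hV : ∀ η : ℝ, 0 < η → ∃ N, 0 < N ∧ DefectBound V η N) {x y : ℕ → V} {R : ℝ}
    (hx : ∀ i, ‖x i‖ ≤ R) (hy : ∀ j, ‖y j‖ ≤ R) {U V' : Ultrafilter ℕ} {g h : ℕ → ℝ} {a b : ℝ}
    (hg : ∀ i, Tendsto (fun j => dist (x i) (y j)) V' (𝓝 (g i))) (ha : Tendsto g U (𝓝 a))
    (hh : ∀ j, Tendsto (fun i => dist (x i) (y j)) U (𝓝 (h j))) (hb : Tendsto h V' (𝓝 b)) :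
    b ≤ a := by
  by_contra! hab
  obtain ⟨α, haα, hαb⟩ := exists_between hab
  obtain ⟨β, hαβ, hβb⟩ := exists_between hαb
  obtain ⟨η, hη, hgap⟩ := exists_pos_mul_lt (sub_pos.2 hαβ) (4 * R)
  obtain ⟨N, hN, hdefect⟩ := hV η hη
  obtain ⟨c, hc⟩ := exists_tendsto_of_forall_abs_le U fun i => (abs_norm (x i)).trans_le (hx i)
  simp only [dist_eq_norm] at hg hh
  refine hdefect.not_shatters hη.le hN (α := α - c) (β := β - c) (by linarith)
    (HasLadder.of_eventually (U := (U : Filter ℕ)) (V := (V' : Filter ℕ)) (.of_forall hx)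
      (.of_forall hy) ?_ ?_ _).shatters
  · filter_upwards [(ha.sub hc).eventually_lt_const (sub_lt_sub_right haα c)] with i hi
    exact ((hg i).sub_const _).eventually_le_const hi
  · filter_upwards [(hb.sub_const c).eventually_const_lt (sub_lt_sub_right hβb c)] with j hj
    exact ((hh j).sub hc).eventually_const_le hj

theorem isStableSpace_of_defectBound
    (hW : ∀ η : ℝ, 0 < η → ∃ N, 0 < N ∧ DefectBound W η N) : IsStableSpace W := by
  intro x y hx hy U V _ _ g h a b hg ha hh hb
  obtain ⟨R, hR⟩ := (hx.union hy).exists_norm_le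
  have hxR (i : ℕ) : ‖x i‖ ≤ R := hR _ (Or.inl ⟨i, rfl⟩)
  have hyR (j : ℕ) : ‖y j‖ ≤ R := hR _ (Or.inr ⟨j, rfl⟩)
  refine le_antisymm ?_ (le_of_iterated_limits_of_defectBound hW hxR hyR hg ha hh hb)
  simp only [dist_comm (x _)] at hg hh
  exact le_of_iterated_limits_of_defectBound hW hyR hxR hh hb hg ha

theorem isSuperstable_of_defectBound {Z : Type v} [NormedAddCommGroup Z] [NormedSpace ℝ Z]
    (hZ : ∀ η : ℝ, 0 < η → ∃ N, 0 < N ∧ DefectBound Z η N) : IsSuperstable.{v, w} Z :=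
  fun _ _ _ _ hW => isStableSpace_of_defectBound fun η hη =>
    (hZ η hη).imp fun _ hN => ⟨hN.1, hW.defectBound hN.2⟩

theorem IsSuperstable.completion_preL1 {I : Type u} [TopologicalSpace I]
    {m : (I →ᵇ ℝ) →ₚ[ℝ] ℝ} {Y : Type v} [NormedAddCommGroup Y] [NormedSpace ℝ Y]
    (hY : IsSuperstable.{v, max u v} Y) :
    IsSuperstable.{max u v, w} (UniformSpace.Completion (PreL1 m Y)) :=
  isSuperstable_of_defectBound fun _ hη =>
    (IsSuperstable.exists_defectBound.{u} hY hη).imp fun _ hN =>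
      ⟨hN.1, (PreL1.defectBound hN.2).completion⟩

end Stability

section InvariantMean

variable {I : Type*} [TopologicalSpace I] {m : (I →ᵇ ℝ) →ₚ[ℝ] ℝ}

theorem exists_ergodic_average (m : (I →ᵇ ℝ) →ₚ[ℝ] ℝ) (τ : C(I, I)) (n : ℕ) :
    ∃ A : (I →ᵇ ℝ) →ₚ[ℝ] ℝ, ∀ f, A f = birkhoffAverage ℝ (·.compContinuous τ) m n f := by
  let T : Module.End ℝ (I →ᵇ ℝ) := (BoundedContinuousFunction.compContinuousCLM ℝ ℝ τ).toLinearMap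
  let L : (I →ᵇ ℝ) →ₗ[ℝ] ℝ := (n : ℝ)⁻¹ • ∑ k ∈ Finset.range n, m.toLinearMap ∘ₗ T ^ k
  have hL (f : I →ᵇ ℝ) : L f = birkhoffAverage ℝ (·.compContinuous τ) m n f := by
    simp only [L, birkhoffAverage, birkhoffSum, LinearMap.smul_apply, LinearMap.sum_apply,
      LinearMap.comp_apply, Module.End.pow_apply]
    rfl
  refine ⟨.mk₀ L fun f hf => ?_, hL⟩
  rw [hL]
  exact smul_nonneg (by positivity) (Finset.sum_nonneg fun k _ => map_nonneg m
    (Function.Iterate.rec (0 ≤ ·) hf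
      (fun g hg => show 0 ≤ g.compContinuous τ from fun i => hg (τ i)) k))

theorem exists_invariant_of_commute (hm : m 1 = 1) (τ : C(I, I)) :
    ∃ M : (I →ᵇ ℝ) →ₚ[ℝ] ℝ, M 1 = 1 ∧ (∀ f, M (f.compContinuous τ) = M f) ∧
      ∀ σ : C(I, I), σ.comp τ = τ.comp σ → (∀ f, m (f.compContinuous σ) = m f) →
        ∀ f, M (f.compContinuous σ) = M f := by
  set T : (I →ᵇ ℝ) → (I →ᵇ ℝ) := (·.compContinuous τ) with hT
  choose A hA using fun n : ℕ => exists_ergodic_average m τ (n + 1)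
  have hA1 (n : ℕ) : A n 1 = 1 := by
    have hfix : Function.IsFixedPt T 1 := rfl
    rw [hA, hfix.birkhoffAverage_eq ℝ m (Nat.cast_ne_zero.2 n.succ_ne_zero), hm]
  obtain ⟨M, hM, hlim⟩ := exists_ultralimit (hyperfilter ℕ) A hA1
  refine ⟨M, hM, fun f => sub_eq_zero.1 ?_, fun σ hσ hmσ f => ?_⟩
  · have hbdd : Bornology.IsBounded (Set.range fun k => m (T^[k] f)) := by
      refine isBounded_iff_forall_norm_le.2 ⟨‖f‖, Set.forall_mem_range.2 fun k => ?_⟩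
      exact (abs_map_le_norm hm _).trans (Function.Iterate.rec (‖·‖ ≤ ‖f‖)
        le_rfl (fun g hg => (g.norm_compContinuous_le τ).trans hg) k)
    refine tendsto_nhds_unique ((hlim (T f)).sub (hlim f)) ?_
    simp only [hA]
    exact ((tendsto_birkhoffAverage_apply_sub_birkhoffAverage ℝ hbdd).comp
      (tendsto_add_atTop_nat 1)).mono_left Nat.hyperfilter_le_atTop
  · refine tendsto_nhds_unique (hlim _) ((hlim f).congr fun n => ?_)
    have hcomm : Function.Commute T (·.compContinuous σ) := fun g =>
      congrArg g.compContinuous hσ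
    simp only [hA, birkhoffAverage, birkhoffSum, (hcomm.iterate_left _).eq, hmσ, ← hT]

theorem exists_invariant_mean [Nonempty I] {ι : Type*} (τ : ι → C(I, I))
    (hτ : ∀ g h, (τ g).comp (τ h) = (τ h).comp (τ g)) :
    ∃ m : (I →ᵇ ℝ) →ₚ[ℝ] ℝ, m 1 = 1 ∧ ∀ g f, m (f.compContinuous (τ g)) = m f := by
  classical
  have hfinite (S : Finset ι) : ∃ m : (I →ᵇ ℝ) →ₚ[ℝ] ℝ, m 1 = 1 ∧
      ∀ g ∈ S, ∀ f, m (f.compContinuous (τ g)) = m f := by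
    induction S using Finset.induction_on with
    | empty =>
      obtain ⟨m, hm⟩ := exists_ultrafilter_limit (pure (Classical.arbitrary I))
      exact ⟨m, tendsto_nhds_unique (hm 1) tendsto_const_nhds, by simp⟩
    | insert h S _ ih =>
      obtain ⟨m, hm, hmS⟩ := ih
      obtain ⟨M, hM, hMh, hMS⟩ := exists_invariant_of_commute hm (τ h)
      exact ⟨M, hM, Finset.forall_mem_insert _ _ _ |>.2
        ⟨hMh, fun g hg => hMS (τ g) (hτ g h) (hmS g hg)⟩⟩
  choose A hA hAinv using hfinite
  obtain ⟨m, hm, hlim⟩ := exists_ultralimit (Ultrafilter.of (atTop : Filter (Finset ι))) A hA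
  refine ⟨m, hm, fun g f => tendsto_nhds_unique (hlim _) ((hlim f).congr' ?_)⟩
  have hlarge : ∀ᶠ S in (Ultrafilter.of (atTop : Filter (Finset ι)) : Filter (Finset ι)),
      {g} ⊆ S :=
    (eventually_ge_atTop ({g} : Finset ι)).filter_mono (Ultrafilter.of_le _)
  filter_upwards [hlarge] with S hS
  exact (hAinv S g (Finset.singleton_subset_iff.1 hS) f).symm

end InvariantMean

section Distances

open AffineMap

variable {X P : Type*} [NormedAddCommGroup X] [NormedSpace ℝ X] [PseudoMetricSpace P]
  {f G : X → P} {t δ ρ : ℝ}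

theorem exists_dist_le_of_uniformContinuous (hf : UniformContinuous f) (R : ℝ) :
    ∃ C, ∀ x y, dist x y ≤ R → dist (f x) (f y) ≤ C := by
  obtain ⟨ρ, hρ, h⟩ := Metric.uniformContinuous_iff.1 hf 1 one_pos
  set n := ⌊R / ρ⌋₊ + 1
  have hn : (0 : ℝ) < n := by positivity
  have hRn : R < n * ρ := (div_lt_iff₀ hρ).1 (by simpa [n] using Nat.lt_floor_add_one (R / ρ))
  refine ⟨n, fun x y hxy => ?_⟩
  let p (k : ℕ) : X := lineMap x y (k / n : ℝ)
  have hp (k : ℕ) : dist (p k) (p (k + 1)) < ρ := by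
    have : dist (k / n : ℝ) ((k + 1 : ℕ) / n : ℝ) = (n : ℝ)⁻¹ := by
      rw [Real.dist_eq, ← sub_div, Nat.cast_succ, sub_add_cancel_left, abs_div, abs_neg, abs_one,
        abs_of_pos hn, one_div]
    rw [dist_lineMap_lineMap, this, inv_mul_lt_iff₀ hn]
    exact hxy.trans_lt hRn
  have hsum := dist_le_range_sum_of_dist_le (f := f ∘ p) n (d := fun _ => 1) fun {k} _ =>
    (h (hp k)).le
  simpa [p, hn.ne'] using hsum

theorem exists_dist_eq_and_dist_eq {x y : X} (hxy : x ≠ y) (ht : 0 ≤ t) :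
    ∃ z, dist x z = t ∧ dist y z = |dist x y - t| := by
  have h0 : 0 < dist x y := dist_pos.2 hxy
  refine ⟨lineMap x y (t / dist x y), ?_, ?_⟩
  · rw [dist_left_lineMap, Real.norm_of_nonneg (by positivity), div_mul_cancel₀ _ h0.ne']
  · rw [dist_right_lineMap, Real.norm_eq_abs, ← abs_of_pos h0, ← abs_mul, abs_of_pos h0, sub_mul,
      div_mul_cancel₀ _ h0.ne', one_mul]

theorem exists_le_dist_of_abs_dist_sub_le (hf : UniformContinuous f) (ht : 0 < t) (hδ : 0 < δ)
    (h : ∀ x y, dist x y = t → δ ≤ dist (f x) (f y)) :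
    ∃ ρ > 0, ∀ x y, |dist x y - t| ≤ ρ → δ / 2 ≤ dist (f x) (f y) := by
  obtain ⟨ρ, hρ, hclose⟩ := Metric.uniformContinuous_iff.1 hf (δ / 2) (half_pos hδ)
  refine ⟨min (ρ / 2) (t / 2), by positivity, fun x y hxy => ?_⟩
  obtain ⟨hxyρ, hxyt⟩ := le_min_iff.1 hxy
  have hne : x ≠ y := by
    rintro rfl
    rw [dist_self, zero_sub, abs_neg, abs_of_pos ht] at hxyt
    linarith
  obtain ⟨z, hxz, hyz⟩ := exists_dist_eq_and_dist_eq hne ht.le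
  have hfxz := h x z hxz
  have hfyz := hclose (hyz.trans_lt (hxyρ.trans_lt (half_lt_self hρ)))
  linarith [dist_triangle (f x) (f y) (f z)]

theorem dist_add_nsmul_le {X : Type*} [AddCommMonoid X] {G : X → P}
    (hG : ∀ x y w, dist (G (x + w)) (G (y + w)) = dist (G x) (G y)) (x w : X) (n : ℕ) :
    dist (G x) (G (x + n • w)) ≤ n * dist (G x) (G (x + w)) := by
  have hstep (k : ℕ) : dist (G (x + k • w)) (G (x + (k + 1) • w)) = dist (G x) (G (x + w)) := by
    rw [succ_nsmul', ← add_assoc, hG]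
  simpa using dist_le_range_sum_of_dist_le (f := fun k : ℕ => G (x + k • w)) n
    (d := fun _ => dist (G x) (G (x + w))) fun {k} _ => (hstep k).le

theorem mul_dist_le_of_le_dist (hG : ∀ x y w, dist (G (x + w)) (G (y + w)) = dist (G x) (G y))
    (ht : 0 < t) (hρ : 0 < ρ) (hlow : ∀ x y, |dist x y - t| ≤ ρ → δ ≤ dist (G x) (G y)) {x y : X}
    (hxy : dist x y ≤ ρ) : δ * dist x y ≤ (t + ρ) * dist (G x) (G y) := by
  rcases (dist_nonneg (x := x) (y := y)).eq_or_lt' with h0 | h0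
  · rw [h0, mul_zero]
    positivity
  set n := ⌈t / dist x y⌉₊
  have ht_le : t ≤ n * dist x y := (div_le_iff₀ h0).1 (Nat.le_ceil _)
  have hle_t : n * dist x y ≤ t + dist x y := by
    have := (Nat.ceil_lt_add_one (show 0 ≤ t / dist x y by positivity)).le
    rwa [div_add_one h0.ne', le_div_iff₀ h0] at this
  have hdist : dist x (x + n • (y - x)) = n * dist x y := by
    rw [dist_self_add_right, ← Nat.cast_smul_eq_nsmul ℝ, norm_smul, Real.norm_natCast,
      dist_eq_norm']
  have hδ : δ ≤ n * dist (G x) (G y) := by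
    refine (hlow x (x + n • (y - x)) ?_).trans ?_
    · rw [hdist, abs_le]
      constructor <;> linarith
    · simpa using dist_add_nsmul_le hG x (y - x) n
  calc δ * dist x y ≤ n * dist (G x) (G y) * dist x y := by gcongr
    _ = n * dist x y * dist (G x) (G y) := by ring
    _ ≤ (t + ρ) * dist (G x) (G y) := by gcongr; linarith

theorem exists_antilipschitzWith_smul_closedBall
    (hG : ∀ x y w, dist (G (x + w)) (G (y + w)) = dist (G x) (G y)) (ht : 0 < t) (hδ : 0 < δ)
    (hρ : 0 < ρ) (hlow : ∀ x y, |dist x y - t| ≤ ρ → δ ≤ dist (G x) (G y)) :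
    ∃ K, AntilipschitzWith K fun x : Metric.closedBall (0 : X) 1 => G ((ρ / 2) • (x : X)) := by
  refine ⟨_, AntilipschitzWith.of_le_mul_dist
    (K := .mk ((t + ρ) / (δ * (ρ / 2))) (by positivity)) fun ⟨x, hx⟩ ⟨y, hy⟩ => ?_⟩
  have hdist : dist ((ρ / 2) • x) ((ρ / 2) • y) = ρ / 2 * dist x y := by
    rw [dist_smul₀, Real.norm_of_nonneg (by positivity)]
  have hxy : dist x y ≤ 2 := by
    linarith [dist_triangle_right x y 0, Metric.mem_closedBall.1 hx, Metric.mem_closedBall.1 hy]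
  have hle := mul_dist_le_of_le_dist hG ht hρ hlow (x := (ρ / 2) • x) (y := (ρ / 2) • y)
    (by rw [hdist]; nlinarith)
  rw [hdist, ← mul_assoc] at hle
  rw [NNReal.coe_mk, div_mul_eq_mul_div, le_div_iff₀' (by positivity)]
  exact hle

end Distances

theorem IsAlmostUncollapsed.exists_le_dist {X : Type u} {Y : Type v} [NormedAddCommGroup X]
    [NormedAddCommGroup Y] {f : X → Y} (hf : IsAlmostUncollapsed f) :
    ∃ t > 0, ∃ δ > 0, ∀ x y, dist x y = t → δ ≤ dist (f x) (f y) := by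
  obtain ⟨t, ht, hpos⟩ := hf
  obtain ⟨c, hc0, hc⟩ := exists_between hpos
  refine ⟨t, ht, c.toReal, ENNReal.toReal_pos hc0.ne' hc.ne_top, fun x y hxy => ?_⟩
  rw [dist_eq_norm] at hxy ⊢
  refine (ENNReal.le_ofReal_iff_toReal_le hc.ne_top (norm_nonneg _)).1 (hc.le.trans ?_)
  exact iInf₂_le_of_le x y (iInf_le _ hxy)

section TranslateMap

variable {X Y : Type*} [NormedAddCommGroup X] [NormedSpace ℝ X] [NormedAddCommGroup Y]
  {f : X → Y} {m : (X →ᵇ ℝ) →ₚ[ℝ] ℝ}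

/-- The function `z ↦ f (x + z) - f z`, which is bounded since `f` is uniformly continuous on a
normed space. -/
noncomputable def translateSub (hf : UniformContinuous f) (x : X) : X →ᵇ Y :=
  .ofNormedAddCommGroup (fun z => f (x + z) - f z)
    ((hf.continuous.comp (continuous_const_add x)).sub hf.continuous)
    (exists_dist_le_of_uniformContinuous hf ‖x‖).choose fun z => by
      rw [← dist_eq_norm]
      exact (exists_dist_le_of_uniformContinuous hf ‖x‖).choose_spec _ _
        (dist_add_self_left z x).le

/-- The map `x ↦ (z ↦ f (x + z) - f z)` into an `L¹` space over `X`: the distances of its values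
are the averages of those of the translates of `f`. -/
noncomputable def translateMap (m : (X →ᵇ ℝ) →ₚ[ℝ] ℝ) (hf : UniformContinuous f) (x : X) :
    PreL1 m Y :=
  PreL1.of m (translateSub hf x)

variable (hf : UniformContinuous f)

theorem normComp_translateSub_sub_apply (x y z : X) :
    (translateSub hf x - translateSub hf y).normComp z = dist (f (x + z)) (f (y + z)) := by
  rw [dist_eq_norm, ← sub_sub_sub_cancel_right _ _ (f z)]
  rfl

theorem dist_translateMap (x y : X) : dist (translateMap m hf x) (translateMap m hf y) =
    m (translateSub hf x - translateSub hf y).normComp := by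
  rw [dist_eq_norm, translateMap, translateMap, ← map_sub, PreL1.norm_of]

theorem uniformContinuous_translateMap (hm : m 1 = 1) : UniformContinuous (translateMap m hf) := by
  refine Metric.uniformContinuous_iff.2 fun ε hε => ?_
  obtain ⟨ρ, hρ, h⟩ := Metric.uniformContinuous_iff.1 hf (ε / 2) (half_pos hε)
  refine ⟨ρ, hρ, fun {x y} hxy => ?_⟩
  rw [dist_translateMap]
  refine ((le_abs_self _).trans (abs_map_le_norm hm _)).trans_lt (LE.le.trans_lt ?_
    (half_lt_self hε))
  refine (BoundedContinuousFunction.norm_le (by positivity)).2 fun z => ?_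
  rw [normComp_translateSub_sub_apply, Real.norm_of_nonneg dist_nonneg]
  exact (h (by rwa [dist_add_right])).le

theorem dist_translateMap_add
    (hinv : ∀ (w : X) (g : X →ᵇ ℝ), m (g.compContinuous (.addLeft w)) = m g) (x y w : X) :
    dist (translateMap m hf (x + w)) (translateMap m hf (y + w)) =
      dist (translateMap m hf x) (translateMap m hf y) := by
  rw [dist_translateMap, dist_translateMap, ← hinv w (translateSub hf x - _).normComp]
  congr 1
  ext z
  simp only [BoundedContinuousFunction.compContinuous_apply, normComp_translateSub_sub_apply,
    ContinuousMap.coe_addLeft, add_assoc]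

theorem le_dist_translateMap (hm : m 1 = 1) {t δ ρ : ℝ}
    (hlow : ∀ x y, |dist x y - t| ≤ ρ → δ ≤ dist (f x) (f y)) {x y : X}
    (hxy : |dist x y - t| ≤ ρ) : δ ≤ dist (translateMap m hf x) (translateMap m hf y) := by
  rw [dist_translateMap]
  refine le_map_of_forall_le hm fun z => ?_
  rw [normComp_translateSub_sub_apply]
  exact hlow _ _ (by rwa [dist_add_right])

end TranslateMap

theorem mainTheorem5_general {X : Type u} [NormedAddCommGroup X] [NormedSpace ℝ X]
    {Y : Type v} [NormedAddCommGroup Y] [NormedSpace ℝ Y] (hY : IsSuperstable.{v, max u v} Y)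
    (f : X → Y) (hf : UniformContinuous f) (hf' : IsAlmostUncollapsed f) :
    ∃ (Z : Type (max u v)) (_ : NormedAddCommGroup Z) (_ : NormedSpace ℝ Z)
      (_ : CompleteSpace Z),
      IsSuperstable.{max u v, w} Z ∧
      ∃ F : X → Z, UniformContinuous F ∧
        IsUniformEmbedding (fun x : Metric.closedBall (0 : X) 1 => F x) ∧
        ∃ K : NNReal, AntilipschitzWith K (fun x : Metric.closedBall (0 : X) 1 => F x) := by
  obtain ⟨t, ht, δ, hδ, hexact⟩ := hf'.exists_le_dist
  obtain ⟨ρ, hρ, hlow⟩ := exists_le_dist_of_abs_dist_sub_le hf ht hδ hexact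
  obtain ⟨m, hm, hinv⟩ := exists_invariant_mean (fun w : X => ContinuousMap.addLeft w)
    fun v w => by ext z; exact add_left_comm v w z
  let G (x : X) : UniformSpace.Completion (PreL1 m Y) := translateMap m hf x
  have hdist (x y : X) : dist (G x) (G y) = dist (translateMap m hf x) (translateMap m hf y) :=
    UniformSpace.Completion.dist_eq _ _
  have hG : UniformContinuous G := (UniformSpace.Completion.uniformContinuous_coe _).comp
    (uniformContinuous_translateMap hf hm)
  obtain ⟨K, hK⟩ := exists_antilipschitzWith_smul_closedBall (G := G)
    (by simpa only [hdist] using dist_translateMap_add hf hinv) ht (half_pos hδ) hρ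
    fun x y hxy => (le_dist_translateMap hf hm hlow hxy).trans_eq (hdist x y).symm
  have hF : UniformContinuous fun x => G ((ρ / 2) • x) :=
    hG.comp (uniformContinuous_const_smul (ρ / 2))
  exact ⟨_, inferInstance, inferInstance, inferInstance, IsSuperstable.completion_preL1.{u} hY,
    _, hF, hK.isUniformEmbedding (hF.comp uniformContinuous_subtype_val), K, hK⟩

theorem mainTheorem5 {X : Type u} [NormedAddCommGroup X] [NormedSpace ℝ X] [CompleteSpace X]
    {Y : Type v} [NormedAddCommGroup Y] [NormedSpace ℝ Y] [CompleteSpace Y]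
    (hY : IsSuperstable.{v, max u v} Y)
    (f : X → Y) (hf : UniformContinuous f) (hf' : IsAlmostUncollapsed f) :
    ∃ (Z : Type (max u v)) (_ : NormedAddCommGroup Z) (_ : NormedSpace ℝ Z)
      (_ : CompleteSpace Z),
      IsSuperstable.{max u v, max u v} Z ∧
      ∃ F : X → Z, UniformContinuous F ∧
        IsUniformEmbedding (fun x : Metric.closedBall (0 : X) 1 => F x) ∧
        ∃ K : NNReal, AntilipschitzWith K (fun x : Metric.closedBall (0 : X) 1 => F x) :=
  mainTheorem5_general hY f hf hf'
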